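/- Let $n\ge 2$ and $d\ge 2$, let $V$ be the real vector space with basis $x_1,\dots,x_n$, and let $L=L[V,d]$ be the free nilpotent real Lie algebra of class $d$ on $x_1,\dots,x_n$ (the free Lie algebra modulo the $(d+1)$-st term of its lower central series), with its grading $L=\bigoplus_{i=1}^d L^{(i)}$ by bracket length, $L^{(1)}=V$. Let $\mathrm{Der}\,L^{(k)}$ be the space of derivations of $L$ that are homogeneous of degree $k$, and put $UL=UL[V,d]=\bigoplus_{k=1}^{d-1}\mathrm{Der}\,L^{(k)}$, $UL^{(d-1)}=\mathrm{Der}\,L^{(d-1)}$. Let $\mathfrak{gl}=\mathfrak{gl}_n$ and $\mathfrak{sl}=\mathfrak{sl}_n$ act on $L$ by the derivations that extend their natural action on $V$. Let $U_{\mathrm{gen}}\subset UL$ be a graded $\mathfrak{sl}$-submodule with $UL=[UL,UL]\oplus U_{\mathrm{gen}}$, and $U_{\mathrm{gen}}^+$ a graded $\mathfrak{sl}$-submodule with $U_{\mathrm{gen}}=\mathrm{ad}(V)\oplus U_{\mathrm{gen}}^+$; such modules exist, and what follows holds for every choice of them. The derivation tower of $L$ is $D^0L=L$, $D^{k+1}L=\mathrm{Der}(D^kL)$,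 with the maps $\mathrm{ad}_k:D^kL\to D^{k+1}L$, $x\mapsto \mathrm{ad}\,x$. It stabilizes at level $k$ if $\mathrm{ad}_k$ is an isomorphism. (a) Suppose $d\ge 3$ or $n\ge 3$. Then the derivation tower of $L$ is $$L[V,d]\to \mathfrak{gl}+UL[V,d]\to \mathfrak{gl}+UL[V,d]+\mathrm{Hom}_{\mathfrak{sl}}\big(U_{\mathrm{gen}}^+\cap UL^{(d-1)},\,UL^{(d-1)}\big),$$ and it stabilizes at the second level. Here the sums are direct sums of vector spaces. In the first one, $\mathfrak{gl}$ is embedded in $D^1L$ as $\mathrm{Der}\,L^{(0)}$, and $D^1L=\bigoplus_{k=0}^{d-1}\mathrm{Der}\,L^{(k)}$. In the second one, $\mathfrak{gl}+UL=D^1L$ is embedded in $D^2L$ by the injective map $\mathrm{ad}_1$, and $\varphi\in\mathrm{Hom}_{\mathfrak{sl}}(\dots)$ is identified with the derivation of $\mathfrak{gl}+UL$ that equals $\varphi$ on $U_{\mathrm{gen}}^+\cap UL^{(d-1)}$ and vanishes on $\mathfrak{gl}$, on $\mathrm{Der}\,L^{(k)}$ for $1\le k<d-1$, on $[UL,UL]$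 and on $\mathrm{ad}(V)$. All the maps $\mathrm{ad}_k$ with $k\ge2$ are isomorphisms. (b) If $n=d=2$, the tower stabilizes at the first level, and all the maps $\mathrm{ad}_k$ with $k\ge1$ are isomorphisms. -/

import Mathlib

attribute [local instance 100] LieRing.ofAssociativeRing

noncomputable section

/-! ### Derivation towers -/

/-- A real Lie algebra, bundled with its carrier. -/
structure BundledLieAlg : Type 1 where
  carrier : Type
  [lieRing : LieRing carrier]
  [lieAlgebra : LieAlgebra ℝ carrier]

attribute [instance] BundledLieAlg.lieRing BundledLieAlg.lieAlgebra

/-- The derivation tower: `D⁰ L = L` and `D^{k+1} L = Der (D^k L)`. -/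
def derivationTower (L : Type) [LieRing L] [LieAlgebra ℝ L] : ℕ → BundledLieAlg
  | 0 => ⟨L⟩
  | k + 1 =>
    ⟨LieDerivation ℝ (derivationTower L k).carrier (derivationTower L k).carrier⟩

/-- The `k`-th map of the derivation tower, `D^k L → D^{k+1} L`, `x ↦ ad x`. -/
def derivationTowerMap (L : Type) [LieRing L] [LieAlgebra ℝ L] (k : ℕ) :
    (derivationTower L k).carrier →ₗ⁅ℝ⁆ (derivationTower L (k + 1)).carrier :=
  LieDerivation.ad ℝ (derivationTower L k).carrier

/-- The derivation tower of `L` stabilizes at level `k`: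
`ad : D^k L → D^{k+1} L` is an isomorphism. -/
def StabilizesAtLevel (L : Type) [LieRing L] [LieAlgebra ℝ L] (k : ℕ) : Prop :=
  Function.Bijective (derivationTowerMap L k)

theorem derivationTower_one (L : Type) [LieRing L] [LieAlgebra ℝ L] :
    derivationTower L 1 = ⟨LieDerivation ℝ L L⟩ := rfl

theorem derivationTower_two (L : Type) [LieRing L] [LieAlgebra ℝ L] :
    derivationTower L 2 =
      ⟨LieDerivation ℝ (LieDerivation ℝ L L) (LieDerivation ℝ L L)⟩ := rfl

/-! ### Free nilpotent Lie algebras and their derivations -/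

/-- The free nilpotent Lie algebra `L[V,d]` of class `d` on the generators `x_j`, `j : Fin n`:
the free Lie algebra modulo the `(d+1)`-st term of its lower central series.
(`lowerCentralSeries` is indexed from `0`.) -/
def FreeNilp (n d : ℕ) : Type :=
  FreeLieAlgebra ℝ (Fin n) ⧸
    LieModule.lowerCentralSeries ℝ (FreeLieAlgebra ℝ (Fin n)) (FreeLieAlgebra ℝ (Fin n)) d

instance (n d : ℕ) : LieRing (FreeNilp n d) :=
  inferInstanceAs (LieRing (FreeLieAlgebra ℝ (Fin n) ⧸
    LieModule.lowerCentralSeries ℝ (FreeLieAlgebra ℝ (Fin n)) (FreeLieAlgebra ℝ (Fin n)) d))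

instance (n d : ℕ) : LieAlgebra ℝ (FreeNilp n d) :=
  inferInstanceAs (LieAlgebra ℝ (FreeLieAlgebra ℝ (Fin n) ⧸
    LieModule.lowerCentralSeries ℝ (FreeLieAlgebra ℝ (Fin n)) (FreeLieAlgebra ℝ (Fin n)) d))

/-- The quotient map from the free Lie algebra onto `L[V,d]`. -/
def FreeNilp.proj (n d : ℕ) : FreeLieAlgebra ℝ (Fin n) →ₗ⁅ℝ⁆ FreeNilp n d where
  toFun a := (LieSubmodule.Quotient.mk a : FreeLieAlgebra ℝ (Fin n) ⧸
    LieModule.lowerCentralSeries ℝ (FreeLieAlgebra ℝ (Fin n)) (FreeLieAlgebra ℝ (Fin n)) d)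
  map_add' _ _ := rfl
  map_smul' _ _ := rfl
  map_lie' := rfl

/-- `D¹ L[V,d]`, the algebra of derivations of `L[V,d]`. -/
abbrev Der1 (n d : ℕ) : Type := LieDerivation ℝ (FreeNilp n d) (FreeNilp n d)

/-- `D² L[V,d]`, the algebra of derivations of `D¹ L[V,d]`. -/
abbrev Der2 (n d : ℕ) : Type := LieDerivation ℝ (Der1 n d) (Der1 n d)

namespace FreeNilp

variable (n d : ℕ)

/-- The generator `x_j`. -/
def gen (j : Fin n) : FreeNilp n d :=
  proj n d (FreeLieAlgebra.of ℝ j)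

/-- The iterated bracket of generators described by a parenthesized word. -/
def bracketWord : FreeMagma (Fin n) → FreeNilp n d
  | .of j => gen n d j
  | .mul a b => ⁅bracketWord a, bracketWord b⁆

/-- The homogeneous component `L[V,d]^{(k)}`, spanned by the iterated brackets of `k` generators;
in particular `V` is the component with `k = 1`. -/
def homog (k : ℕ) : Submodule ℝ (FreeNilp n d) :=
  Submodule.span ℝ {y | ∃ w : FreeMagma (Fin n), w.length = k ∧ y = bracketWord n d w}

/-- The space `D L^{(k)}` of derivations of `L[V,d]` that are homogeneous of degree `k`. -/
def derDeg (k : ℕ) : Submodule ℝ (Der1 n d) where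
  carrier := {δ | ∀ m, ∀ y ∈ homog n d m, δ y ∈ homog n d (m + k)}
  zero_mem' := fun _ _ _ => by simp
  add_mem' := fun ha hb m y hy => by
    simpa using add_mem (ha m y hy) (hb m y hy)
  smul_mem' := fun c _ ha m y hy => by
    simpa using Submodule.smul_mem _ c (ha m y hy)

/-- `UL[V,d] = ⨁_{k=1}^{d-1} D L^{(k)}`. -/
def UL : Submodule ℝ (Der1 n d) := ⨆ k ∈ Finset.Icc 1 (d - 1), derDeg n d k

/-- `[UL,UL]`. -/
def commUL : Submodule ℝ (Der1 n d) :=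
  Submodule.span ℝ {δ | ∃ a ∈ UL n d, ∃ b ∈ UL n d, δ = ⁅a, b⁆}

/-- `ad(V)`, the inner derivations given by the elements of `V`. -/
def adV : Submodule ℝ (Der1 n d) :=
  (homog n d 1).map (LieDerivation.ad ℝ (FreeNilp n d) : FreeNilp n d →ₗ[ℝ] Der1 n d)

/-- `𝔰𝔩` inside `D¹ L[V,d]`: the derivations that act on `V` by a traceless matrix. -/
def slDer : Set (Der1 n d) :=
  {s | ∃ A : Matrix (Fin n) (Fin n) ℝ, A.trace = 0 ∧
    ∀ j, s (gen n d j) = ∑ i, A i j • gen n d i}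

variable {n d}

/-- `U` is a graded `𝔰𝔩`-submodule of `D¹ L[V,d]`. -/
structure IsGradedSlSubmodule (U : Submodule ℝ (Der1 n d)) : Prop where
  lie_mem : ∀ s ∈ slDer n d, ∀ u ∈ U, ⁅s, u⁆ ∈ U
  graded : U = ⨆ k, U ⊓ derDeg n d k

/-- `U` is an admissible choice of `U_gen`: a graded `𝔰𝔩`-submodule of `UL` with
`UL = [UL,UL] ⊕ U`. -/
structure IsUgen (U : Submodule ℝ (Der1 n d)) : Prop extends IsGradedSlSubmodule U where
  disjoint : Disjoint (commUL n d) U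
  sup_eq : commUL n d ⊔ U = UL n d

/-- `P` is an admissible choice of `U_gen⁺` for the choice `U` of `U_gen`:
a graded `𝔰𝔩`-submodule with `U = ad(V) ⊕ P`. -/
structure IsUgenPlus (U P : Submodule ℝ (Der1 n d)) : Prop extends IsGradedSlSubmodule P where
  disjoint : Disjoint (adV n d) P
  sup_eq : adV n d ⊔ P = U

/-- `Hom_𝔰𝔩(M, N)` for `𝔰𝔩`-submodules `M`, `N` of `D¹ L[V,d]`: the linear maps `φ` with
`φ [s,u] = [s, φ u]` for `s ∈ 𝔰𝔩`, `u ∈ M`. -/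
def homSl (M N : Submodule ℝ (Der1 n d)) : Submodule ℝ (M →ₗ[ℝ] N) where
  carrier := {φ | ∀ s ∈ slDer n d, ∀ u v : M, (v : Der1 n d) = ⁅s, (u : Der1 n d)⁆ →
    (φ v : Der1 n d) = ⁅s, (φ u : Der1 n d)⁆}
  zero_mem' := fun _ _ _ _ _ => by simp
  add_mem' := fun ha hb s hs u v h => by
    simp [ha s hs u v h, hb s hs u v h]
  smul_mem' := fun c _ ha s hs u v h => by
    simp [ha s hs u v h]

end FreeNilp

end

noncomputable section

/-! Everything is governed by the Euler derivation `E = glAct n d 1`, which acts on `L^{(k)}` by the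
scalar `k`; its bracket acts on derivations of degree `k` by `k`. Thus gradings are eigenspace
decompositions, and `ad E` has no Jordan blocks. The second basic fact is that the centre of `L`
lies in degree `d` (`eq_zero_of_lie_gen_eq_zero`), which makes `ad` injective on `D¹ L`.

Let `D` be a derivation of `D¹ L`. Modulo inner derivations `D E` has degree 0. Then `D` preserves
degrees and `D E` is central, hence zero. On `𝔤𝔩` it becomes a derivation killing the identity, so
it is inner there by a Casimir argument. Once `D` kills `𝔤𝔩` it commutes with `𝔤𝔩`, so it is a
scalar on `ad V`, and a multiple of `ad E` removes that scalar. The result, `exists_isOuter_sub_ad`,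
is a `D` vanishing on `𝔤𝔩` and `ad V`. Such a `D` kills `ad L`, hence every degree below `d - 1`,
and its values lie in degree `d - 1`, which is central in `UL`. So it kills `[UL,UL]` and amounts to
an equivariant map on `U_gen⁺ ∩ UL^{(d-1)}`. Conversely each such map, extended by zero, is a
derivation (`extendZero_leibniz`).

Let `Δ` be a derivation of `D² L`. After an inner correction `Δ (ad E) = ad x₀ + h` with `x₀` of
degree 0 and `h` outer. Applying `Δ` to `[E, a] = k a` forces `x₀ = 0` and `h = 0`, so `Δ` preserves
`ad (D¹ L)` and is inner (`ad_der2_bijective`). Bijectivity of `ad` passes to all later levels. For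
`n = d = 2` every derivation of degree 1 is in `ad V`, so nothing outer remains at the first level.

The modules `U_gen` and `U_gen⁺` exist by complete reducibility, obtained from inner products for
which transposed matrices act as adjoints. -/

lemma LieAlgebra.lie_mem_of_mem_span {R K : Type*} [CommRing R] [LieRing K] [LieAlgebra R K]
    {S T : Set K} {N : Submodule R K} (h : ∀ s ∈ S, ∀ t ∈ T, ⁅s, t⁆ ∈ N) {x y : K}
    (hx : x ∈ Submodule.span R S) (hy : y ∈ Submodule.span R T) : ⁅x, y⁆ ∈ N := by
  induction hx, hy using Submodule.span_induction₂ with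
  | mem_mem x y hx hy => exact h x hx y hy
  | zero_left => simp
  | zero_right => simp
  | add_left x y z _ _ _ h1 h2 => rw [add_lie]; exact add_mem h1 h2
  | add_right x y z _ _ _ h1 h2 => rw [lie_add]; exact add_mem h1 h2
  | smul_left r x y _ _ h => rw [smul_lie]; exact Submodule.smul_mem _ _ h
  | smul_right r x y _ _ h => rw [lie_smul]; exact Submodule.smul_mem _ _ h

/-! ### The Lie algebra of dual numbers over a Lie algebra -/

/-- The Lie algebra `K[ε]`, with `ε² = 0`: pairs `(a, b)` standing for `a + ε b`. -/
@[ext]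
structure DualLie (K : Type*) where
  fst : K
  snd : K

namespace DualLie

variable {K : Type*} [LieRing K]

/-- The underlying product. -/
def equivProd : DualLie K ≃ K × K where
  toFun z := (z.fst, z.snd)
  invFun z := ⟨z.1, z.2⟩
  left_inv _ := rfl
  right_inv _ := rfl

instance : AddCommGroup (DualLie K) := equivProd.addCommGroup

instance [LieAlgebra ℝ K] : Module ℝ (DualLie K) := equivProd.module ℝ

@[simp] lemma zero_fst : (0 : DualLie K).fst = 0 := rfl
@[simp] lemma zero_snd : (0 : DualLie K).snd = 0 := rfl
@[simp] lemma add_fst (x y : DualLie K) : (x + y).fst = x.fst + y.fst := rfl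
@[simp] lemma add_snd (x y : DualLie K) : (x + y).snd = x.snd + y.snd := rfl
@[simp] lemma smul_fst [LieAlgebra ℝ K] (c : ℝ) (x : DualLie K) : (c • x).fst = c • x.fst := rfl
@[simp] lemma smul_snd [LieAlgebra ℝ K] (c : ℝ) (x : DualLie K) : (c • x).snd = c • x.snd := rfl

instance : Bracket (DualLie K) (DualLie K) where
  bracket x y := ⟨⁅x.fst, y.fst⁆, ⁅x.fst, y.snd⁆ + ⁅x.snd, y.fst⁆⟩

@[simp] lemma lie_fst (x y : DualLie K) : ⁅x, y⁆.fst = ⁅x.fst, y.fst⁆ := rfl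
@[simp] lemma lie_snd (x y : DualLie K) : ⁅x, y⁆.snd = ⁅x.fst, y.snd⁆ + ⁅x.snd, y.fst⁆ := rfl

instance : LieRing (DualLie K) where
  add_lie x y z := by ext <;> simp; abel
  lie_add x y z := by ext <;> simp; abel
  lie_self x := by
    ext
    · simp
    · rw [lie_snd, ← lie_skew x.fst x.snd, neg_add_cancel, zero_snd]
  leibniz_lie x y z := by ext <;> simp; abel

variable [LieAlgebra ℝ K]

instance : LieAlgebra ℝ (DualLie K) where
  lie_smul c x y := by ext <;> simp

/-- The projection `a + ε b ↦ a`. -/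
def fstHom : DualLie K →ₗ⁅ℝ⁆ K where
  toFun := fst
  map_add' _ _ := rfl
  map_smul' _ _ := rfl
  map_lie' := rfl

/-- Consequently the dual numbers over an algebra of class `d` have class at most `d`, and
homomorphisms from the free Lie algebra to them factor through `L[V,d]`. -/
lemma mem_lowerCentralSeries (k : ℕ) {z : DualLie K}
    (hz : z ∈ LieModule.lowerCentralSeries ℝ (DualLie K) (DualLie K) k) :
    z.fst ∈ LieModule.lowerCentralSeries ℝ K K k ∧ z.snd ∈ LieModule.lowerCentralSeries ℝ K K k := by
  induction k generalizing z with
  | zero => simp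
  | succ k ih =>
    rw [LieModule.lowerCentralSeries_succ, ← LieSubmodule.mem_toSubmodule,
      LieSubmodule.lieIdeal_oper_eq_linear_span'] at hz
    rw [LieModule.lowerCentralSeries_succ]
    induction hz using Submodule.span_induction with
    | mem x hx =>
      obtain ⟨a, -, b, hb, rfl⟩ := hx
      obtain ⟨h1, h2⟩ := ih hb
      have t (u : K) : u ∈ (⊤ : LieIdeal ℝ K) := LieSubmodule.mem_top u
      exact ⟨LieSubmodule.lie_mem_lie (t _) h1,
        add_mem (LieSubmodule.lie_mem_lie (t _) h2) (LieSubmodule.lie_mem_lie (t _) h1)⟩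
    | zero => exact ⟨zero_mem _, zero_mem _⟩
    | add x y _ _ hx hy => exact ⟨add_mem hx.1 hy.1, add_mem hx.2 hy.2⟩
    | smul c x _ hx => exact ⟨SMulMemClass.smul_mem c hx.1, SMulMemClass.smul_mem c hx.2⟩

end DualLie

/-! ### Derivations of `L[V,d]` from values on generators, and the action of `𝔤𝔩` -/

namespace FreeNilp

variable {n d : ℕ}

lemma proj_surjective : Function.Surjective (proj n d) :=
  LieSubmodule.Quotient.surjective_mk' _

lemma proj_eq_zero_iff {a : FreeLieAlgebra ℝ (Fin n)} : proj n d a = 0 ↔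
    a ∈ LieModule.lowerCentralSeries ℝ (FreeLieAlgebra ℝ (Fin n)) (FreeLieAlgebra ℝ (Fin n)) d :=
  LieSubmodule.Quotient.mk_eq_zero'

lemma lowerCentralSeries_eq_bot :
    LieModule.lowerCentralSeries ℝ (FreeNilp n d) (FreeNilp n d) d = ⊥ := by
  rw [← LieIdeal.lowerCentralSeries_map_eq d (proj_surjective (n := n) (d := d)), eq_bot_iff]
  rintro y hy
  obtain ⟨⟨x, hx⟩, rfl⟩ := LieIdeal.mem_map_of_surjective proj_surjective hy
  simpa using proj_eq_zero_iff.2 hx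

/-- The free Lie algebra is generated by its generators. -/
lemma _root_.FreeLieAlgebra.induction_lie {p : FreeLieAlgebra ℝ (Fin n) → Prop}
    (of : ∀ i, p (FreeLieAlgebra.of ℝ i)) (zero : p 0) (add : ∀ a b, p a → p b → p (a + b))
    (smul : ∀ (c : ℝ) a, p a → p (c • a)) (lie : ∀ a b, p a → p b → p ⁅a, b⁆)
    (a : FreeLieAlgebra ℝ (Fin n)) : p a := by
  let S : LieSubalgebra ℝ (FreeLieAlgebra ℝ (Fin n)) :=
    { carrier := {a | p a}
      zero_mem' := zero
      add_mem' := fun ha hb => add _ _ ha hb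
      smul_mem' := fun c _ ha => smul c _ ha
      lie_mem' := fun ha hb => lie _ _ ha hb }
  let f : FreeLieAlgebra ℝ (Fin n) →ₗ⁅ℝ⁆ S :=
    FreeLieAlgebra.lift ℝ fun i => ⟨FreeLieAlgebra.of ℝ i, of i⟩
  -- Both sides agree on generators, so every element is the image of an element of `S`.
  have h : S.incl.comp f = LieHom.id := by
    ext i
    simp [f]
  have := (f a).2
  rwa [show (f a : FreeLieAlgebra ℝ (Fin n)) = a from LieHom.congr_fun h a] at this

lemma iSup_homog : ⨆ k, homog n d k = ⊤ := by
  have key : ∀ y ∈ Submodule.span ℝ (Set.range (bracketWord n d)), y ∈ ⨆ k, homog n d k := by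
    intro y hy
    refine Submodule.span_le.2 ?_ hy
    rintro _ ⟨w, rfl⟩
    exact Submodule.mem_iSup_of_mem w.length (Submodule.subset_span ⟨w, rfl, rfl⟩)
  rw [eq_top_iff]
  rintro y -
  obtain ⟨a, rfl⟩ := proj_surjective y
  apply key
  induction a using FreeLieAlgebra.induction_lie with
  | of i => exact Submodule.subset_span ⟨.of i, rfl⟩
  | zero => simp
  | add a b ha hb => rw [map_add]; exact add_mem ha hb
  | smul c a ha => rw [map_smul]; exact Submodule.smul_mem _ c ha
  | lie a b ha hb =>
    rw [LieHom.map_lie]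
    refine LieAlgebra.lie_mem_of_mem_span ?_ ha hb
    rintro _ ⟨u, rfl⟩ _ ⟨v, rfl⟩
    exact Submodule.subset_span ⟨u * v, rfl⟩

/-- A derivation `δ` is the same as a homomorphism `y ↦ y + ε δ y` into the dual numbers, and
homomorphisms may be prescribed on generators. -/
lemma exists_derivation (f : Fin n → FreeNilp n d) : ∃ δ : Der1 n d, ∀ j, δ (gen n d j) = f j := by
  let Ψ : FreeLieAlgebra ℝ (Fin n) →ₗ⁅ℝ⁆ DualLie (FreeNilp n d) :=
    FreeLieAlgebra.lift ℝ fun j => ⟨gen n d j, f j⟩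
  have h1 : ∀ a, (Ψ a).fst = proj n d a := by
    have : DualLie.fstHom.comp Ψ = proj n d := by
      ext j
      simp only [LieHom.comp_apply, Ψ, FreeLieAlgebra.lift_of_apply]
      rfl
    exact fun a => LieHom.congr_fun this a
  -- The `ε`-part depends only on the class in `L[V,d]`, so it may be computed on any lift `s y`.
  have h2 : ∀ a b, proj n d a = proj n d b → (Ψ a).snd = (Ψ b).snd := by
    intro a b hab
    rw [← sub_eq_zero, ← map_sub, proj_eq_zero_iff] at hab
    have := LieIdeal.map_lowerCentralSeries_le d (f := Ψ) (LieIdeal.mem_map hab)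
    have := (DualLie.mem_lowerCentralSeries d this).2
    rw [lowerCentralSeries_eq_bot, LieSubmodule.mem_bot, map_sub] at this
    rw [← sub_eq_zero, ← this, sub_eq_add_neg, sub_eq_add_neg]
    rfl
  let s := Function.surjInv (proj_surjective (n := n) (d := d))
  have hs : ∀ y, proj n d (s y) = y := Function.surjInv_eq _
  refine ⟨⟨⟨⟨fun y => (Ψ (s y)).snd, ?_⟩, ?_⟩, ?_⟩, ?_⟩
  · intro x y
    rw [h2 _ (s x + s y) (by simp [hs]), map_add, DualLie.add_snd]
  · intro c x
    simp only [RingHom.id_apply]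
    rw [h2 _ (c • s x) (by simp [hs]), map_smul, DualLie.smul_snd]
  · intro x y
    simp only [LinearMap.coe_mk, AddHom.coe_mk]
    rw [h2 _ ⁅s x, s y⁆ (by simp [hs]), LieHom.map_lie, DualLie.lie_snd, h1, h1, hs, hs,
      ← lie_skew y, sub_neg_eq_add]
  · intro j
    change (Ψ (s (gen n d j))).snd = f j
    rw [h2 _ (FreeLieAlgebra.of ℝ j) (by rw [hs]; rfl)]
    simp [Ψ]

lemma derivation_ext {δ δ' : Der1 n d} (h : ∀ j, δ (gen n d j) = δ' (gen n d j)) : δ = δ' := by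
  ext y
  obtain ⟨a, rfl⟩ := proj_surjective y
  induction a using FreeLieAlgebra.induction_lie with
  | of i => exact h i
  | zero => simp
  | add a b ha hb => simp [ha, hb]
  | smul c a ha => simp [ha]
  | lie a b ha hb => simp [ha, hb]

/-- A derivation is determined by its values on the generators, which may be chosen freely. -/
def evalGen (n d : ℕ) : Der1 n d ≃ₗ[ℝ] (Fin n → FreeNilp n d) :=
  LinearEquiv.ofBijective
    { toFun := fun δ j => δ (gen n d j)
      map_add' := fun _ _ => rfl
      map_smul' := fun _ _ => rfl }
    ⟨fun _ _ h => derivation_ext (congrFun h),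
      fun f => (exists_derivation f).imp fun _ h => funext h⟩

@[simp] lemma evalGen_apply (δ : Der1 n d) (j : Fin n) : evalGen n d δ j = δ (gen n d j) := rfl

@[simp] lemma evalGen_symm_gen (f : Fin n → FreeNilp n d) (j : Fin n) :
    (evalGen n d).symm f (gen n d j) = f j :=
  congrFun ((evalGen n d).apply_symm_apply f) j

/-- The natural action of `𝔤𝔩` on `L[V,d]`. -/
def glAct (n d : ℕ) : Matrix (Fin n) (Fin n) ℝ →ₗ⁅ℝ⁆ Der1 n d where
  toFun A := (evalGen n d).symm fun j => ∑ i, A i j • gen n d i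
  map_add' A B := by
    apply derivation_ext
    simp [add_smul, Finset.sum_add_distrib]
  map_smul' c A := by
    apply derivation_ext
    simp [mul_smul, Finset.smul_sum]
  map_lie' {A B} := by
    apply derivation_ext
    intro j
    have (A B : Matrix (Fin n) (Fin n) ℝ) : ∑ i, (A * B) i j • gen n d i =
        ∑ i, B i j • ∑ k, A k i • gen n d k := by
      simp_rw [Matrix.mul_apply, Finset.sum_smul, Finset.smul_sum, mul_smul]
      rw [Finset.sum_comm]
      exact Finset.sum_congr rfl fun _ _ => Finset.sum_congr rfl fun _ _ => smul_comm _ _ _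
    simp [Ring.lie_def, sub_smul, Finset.sum_sub_distrib, this]

@[simp] lemma glAct_gen (A : Matrix (Fin n) (Fin n) ℝ) (j : Fin n) :
    glAct n d A (gen n d j) = ∑ i, A i j • gen n d i := by
  change (evalGen n d).symm _ _ = _
  simp

lemma glAct_single_gen (i j k : Fin n) :
    glAct n d (Matrix.single i j 1) (gen n d k) = if j = k then gen n d i else 0 := by
  simp [Matrix.single_apply, ite_and]

lemma glAct_one_bracketWord (w : FreeMagma (Fin n)) :
    glAct n d 1 (bracketWord n d w) = (w.length : ℝ) • bracketWord n d w := by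
  induction w using FreeMagma.rec with
  | of i => simp [bracketWord, Matrix.one_apply, FreeMagma.length]
  | mul a b ha hb =>
    simp only [bracketWord, FreeMagma.length] at *
    rw [LieDerivation.apply_lie_eq_add]
    simp [ha, hb, add_smul, add_comm]

lemma glAct_one_homog {k : ℕ} {y : FreeNilp n d} (hy : y ∈ homog n d k) :
    glAct n d 1 y = (k : ℝ) • y := by
  induction hy using Submodule.span_induction with
  | mem x hx =>
    obtain ⟨w, rfl, rfl⟩ := hx
    exact glAct_one_bracketWord w
  | zero => simp
  | add x y _ _ hx hy => simp [hx, hy]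
  | smul c x _ hx => rw [map_smul, hx, smul_comm]

lemma gen_mem_homog (j : Fin n) : gen n d j ∈ homog n d 1 :=
  Submodule.subset_span ⟨.of j, rfl, rfl⟩

lemma mem_homog_one {y : FreeNilp n d} :
    y ∈ homog n d 1 ↔ ∃ c : Fin n → ℝ, y = ∑ i, c i • gen n d i := by
  have : {y | ∃ w : FreeMagma (Fin n), w.length = 1 ∧ y = bracketWord n d w} =
      Set.range (gen n d) := by
    ext y
    constructor
    · rintro ⟨w, hw, rfl⟩
      cases w with
      | of i => exact ⟨i, rfl⟩
      | mul a b =>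
        have := a.length_pos
        have := b.length_pos
        simp [FreeMagma.length] at hw
        omega
    · rintro ⟨i, rfl⟩
      exact ⟨.of i, rfl, rfl⟩
  rw [homog, this, Submodule.mem_span_range_iff_exists_fun]
  simp only [eq_comm]

lemma homog_zero : homog n d 0 = ⊥ := by
  rw [homog, Submodule.span_eq_bot]
  rintro _ ⟨w, hw, -⟩
  exact absurd hw w.length_pos.ne'

lemma lie_mem_homog {a b : ℕ} {x y : FreeNilp n d} (hx : x ∈ homog n d a) (hy : y ∈ homog n d b) :
    ⁅x, y⁆ ∈ homog n d (a + b) := by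
  refine LieAlgebra.lie_mem_of_mem_span ?_ hx hy
  rintro _ ⟨u, rfl, rfl⟩ _ ⟨v, rfl, rfl⟩
  exact Submodule.subset_span ⟨u * v, rfl, rfl⟩

/-- The span of the right-normed brackets of `k + 1` generators. -/
def rightNormed (n d : ℕ) : ℕ → Submodule ℝ (FreeNilp n d)
  | 0 => Submodule.span ℝ (Set.range (gen n d))
  | k + 1 => Submodule.span ℝ {z | ∃ j, ∃ y ∈ rightNormed n d k, z = ⁅gen n d j, y⁆}

/-- The Jacobi identity `[[x_j,u],y] = [x_j,[u,y]] - [u,[x_j,y]]` shortens the left factor. Index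
`k` means `k + 1` generators, whence the final `+ 1`. -/
lemma lie_mem_rightNormed (a b : ℕ) {x y : FreeNilp n d} (hx : x ∈ rightNormed n d a)
    (hy : y ∈ rightNormed n d b) : ⁅x, y⁆ ∈ rightNormed n d (a + b + 1) := by
  have one (j : Fin n) (b : ℕ) {y} (hy : y ∈ rightNormed n d b) :
      ⁅gen n d j, y⁆ ∈ rightNormed n d (b + 1) := Submodule.subset_span ⟨j, y, hy, rfl⟩
  induction a generalizing b x y with
  | zero =>
    rw [← Submodule.span_eq (rightNormed n d b)] at hy
    refine LieAlgebra.lie_mem_of_mem_span ?_ hx hy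
    rintro _ ⟨j, rfl⟩ y hy
    simpa using one j b hy
  | succ a ih =>
    rw [← Submodule.span_eq (rightNormed n d b)] at hy
    refine LieAlgebra.lie_mem_of_mem_span ?_ hx hy
    rintro _ ⟨j, u, hu, rfl⟩ y hy
    rw [lie_lie]
    refine sub_mem ?_ ?_
    · have := one j _ (ih b hu hy)
      rwa [show a + 1 + b + 1 = a + b + 1 + 1 by ring]
    · have := ih (b + 1) hu (one j b hy)
      rwa [show a + 1 + b + 1 = a + (b + 1) + 1 by ring]

lemma homog_succ (k : ℕ) : homog n d (k + 1) = rightNormed n d k := by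
  apply le_antisymm
  · have key : ∀ w : FreeMagma (Fin n), ∀ k, w.length = k + 1 →
        bracketWord n d w ∈ rightNormed n d k := by
      intro w
      induction w using FreeMagma.rec with
      | of i =>
        intro k hk
        obtain rfl : k = 0 := by simpa [FreeMagma.length] using hk.symm
        exact Submodule.subset_span ⟨i, rfl⟩
      | mul u v hu hv =>
        intro k hk
        have h1 := u.length_pos
        have h2 := v.length_pos
        simp only [FreeMagma.length] at hk
        have := lie_mem_rightNormed _ _ (hu (u.length - 1) (by omega)) (hv (v.length - 1) (by omega))
        rwa [show u.length - 1 + (v.length - 1) + 1 = k by omega] at this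
    refine Submodule.span_le.2 ?_
    rintro _ ⟨w, hw, rfl⟩
    exact key w k hw
  · induction k with
    | zero =>
      refine Submodule.span_le.2 ?_
      rintro _ ⟨i, rfl⟩
      exact gen_mem_homog i
    | succ k ih =>
      refine Submodule.span_le.2 ?_
      rintro _ ⟨i, y, hy, rfl⟩
      rw [add_comm]
      exact lie_mem_homog (gen_mem_homog i) (ih hy)

/-- A right-normed bracket of `k + 1` generators is visibly in the term of index `k` of the lower
central series. -/
lemma homog_eq_bot {k : ℕ} (hk : d < k) : homog n d k = ⊥ := by
  have key : ∀ k, rightNormed n d k ≤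
      (LieModule.lowerCentralSeries ℝ (FreeNilp n d) (FreeNilp n d) k).toSubmodule := by
    intro k
    induction k with
    | zero => simp
    | succ k ih =>
      refine Submodule.span_le.2 ?_
      rintro _ ⟨i, y, hy, rfl⟩
      rw [LieModule.lowerCentralSeries_succ]
      exact LieSubmodule.lie_mem_lie (LieSubmodule.mem_top _) (ih hy)
  obtain ⟨k, rfl⟩ : ∃ j, k = j + 1 := ⟨k - 1, by omega⟩
  rw [homog_succ, eq_bot_iff]
  refine (key k).trans ?_
  intro y hy
  have := LieModule.antitone_lowerCentralSeries ℝ (FreeNilp n d) (FreeNilp n d)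
    (show d ≤ k by omega) hy
  simpa [lowerCentralSeries_eq_bot] using this

end FreeNilp

/-! ### Diagonalizable endomorphisms with eigenvalues in `ℕ` -/

namespace DiagEnd

open Polynomial

variable {M : Type*} [AddCommGroup M] [Module ℝ M] {T : Module.End ℝ M} {H : ℕ → Submodule ℝ M}
  {N : ℕ}

/-- The projection onto the `k`-eigenspace of an endomorphism `T` which is diagonalizable with
eigenvalues `0, …, N - 1`. -/
def component (T : Module.End ℝ M) (N k : ℕ) : Module.End ℝ M :=
  aeval T (Lagrange.basis (Finset.range N) (fun i : ℕ => (i : ℝ)) k)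

lemma aeval_apply_of_eigenvector {c : ℝ} {y : M} (hy : T y = c • y) (p : ℝ[X]) :
    aeval T p y = p.eval c • y := by
  induction p using Polynomial.induction_on' with
  | add p q hp hq => simp [hp, hq, add_smul]
  | monomial m a =>
    have : (T ^ m) y = c ^ m • y := by
      induction m with
      | zero => simp
      | succ m ih => rw [pow_succ', Module.End.mul_apply, ih, map_smul, hy, smul_smul, pow_succ]
    simp [aeval_monomial, this, smul_smul, mul_comm]

lemma component_apply {j k : ℕ} (hj : j < N) (hk : k < N) {y : M} (hy : T y = (j : ℝ) • y) :
    component T N k y = if j = k then y else 0 := by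
  rw [component, aeval_apply_of_eigenvector hy]
  split_ifs with h
  · subst h
    rw [Lagrange.eval_basis_self (fun _ _ _ _ h => Nat.cast_injective h) (by simpa using hk),
      one_smul]
  · rw [Lagrange.eval_basis_of_ne (Ne.symm h) (by simpa using hj), zero_smul]

/-- The projection is a polynomial in `T`, so it preserves every `T`-stable subspace. -/
lemma component_mem {S : Submodule ℝ M} (hS : ∀ y ∈ S, T y ∈ S) (k : ℕ) {y : M} (hy : y ∈ S) :
    component T N k y ∈ S := by
  rw [component]
  generalize Lagrange.basis (Finset.range N) (fun i : ℕ => (i : ℝ)) k = p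
  induction p using Polynomial.induction_on' with
  | add p q hp hq => simpa using add_mem hp hq
  | monomial m a =>
    have : (T ^ m) y ∈ S := by
      induction m with
      | zero => simpa
      | succ m ih => rw [pow_succ', Module.End.mul_apply]; exact hS _ ih
    simpa [aeval_monomial] using S.smul_mem a this

lemma sum_component (hN : 0 < N) (y : M) : ∑ k ∈ Finset.range N, component T N k y = y := by
  simp_rw [component, ← LinearMap.sum_apply, ← map_sum]
  rw [Lagrange.sum_basis (fun _ _ _ _ h => Nat.cast_injective h) ⟨0, by simpa⟩]
  simp

lemma component_comm (k : ℕ) (y : M) : component T N k (T y) = T (component T N k y) := by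
  have := congrArg (aeval T)
    (mul_comm (Lagrange.basis (Finset.range N) (fun i : ℕ => (i : ℝ)) k) X)
  rw [map_mul, map_mul, aeval_X] at this
  exact LinearMap.congr_fun this y

variable (hH : ∀ k, ∀ y ∈ H k, T y = (k : ℝ) • y) (htop : ⨆ k, H k = ⊤)
  (hbot : ∀ k, N ≤ k → H k = ⊥)

include hH htop hbot

lemma component_mem_of_iSup {k : ℕ} (hk : k < N) (y : M) : component T N k y ∈ H k := by
  have hy : y ∈ ⨆ k, H k := htop ▸ Submodule.mem_top
  induction hy using Submodule.iSup_induction' with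
  | mem j x hx =>
    by_cases hj : j < N
    · rw [component_apply hj hk (hH j x hx)]
      split_ifs with h
      · exact h ▸ hx
      · exact zero_mem _
    · rw [hbot j (by omega), Submodule.mem_bot] at hx
      simp [hx]
  | zero => simp
  | add x y _ _ hx hy => simpa using add_mem hx hy

lemma mem_of_apply_eq {k : ℕ} {y : M} (hy : T y = (k : ℝ) • y) : y ∈ H k := by
  -- The range of eigenvalues is enlarged so that `k` is one of the interpolation nodes even when `N
  -- ≤ k`.
  have := component_mem_of_iSup (N := max N (k + 1)) hH htop
    (fun j hj => hbot j ((le_max_left _ _).trans hj)) (k := k) (by simp) y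
  rwa [component_apply (by simp) (by simp) hy, if_pos rfl] at this

/-- Absence of Jordan blocks: `(T - k) y` equals its own projection to the `k`-eigenspace, which is
`T - k` applied to the projection of `y`, that is, zero. -/
lemma sub_apply_eq_zero {k : ℕ} {y : M}
    (hy : T (T y - (k : ℝ) • y) = (k : ℝ) • (T y - (k : ℝ) • y)) : T y = (k : ℝ) • y := by
  have hk : k < max N (k + 1) := by simp
  have h1 := component_apply hk hk hy
  have h2 := hH k _ (component_mem_of_iSup (N := max N (k + 1)) hH htop
    (fun j hj => hbot j ((le_max_left _ _).trans hj)) hk y)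
  rw [if_pos rfl, map_sub, map_smul, component_comm, h2, sub_self] at h1
  exact sub_eq_zero.1 h1.symm

lemma eq_iSup_inf {S : Submodule ℝ M} (hS : ∀ y ∈ S, T y ∈ S) : S = ⨆ k, S ⊓ H k := by
  refine le_antisymm (fun y hy => ?_) (iSup_le fun _ => inf_le_left)
  have hb : ∀ j, N + 1 ≤ j → H j = ⊥ := fun j hj => hbot j (by omega)
  rw [← sum_component (T := T) (Nat.succ_pos N) y]
  exact Submodule.sum_mem _ fun k hk => Submodule.mem_iSup_of_mem k
    ⟨component_mem hS k hy, component_mem_of_iSup hH htop hb (Finset.mem_range.1 hk) y⟩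

end DiagEnd

/-! ### Degrees as eigenvalues of the Euler derivation -/

namespace FreeNilp

variable {n d : ℕ}

lemma mem_homog {k : ℕ} {y : FreeNilp n d} : y ∈ homog n d k ↔ glAct n d 1 y = (k : ℝ) • y :=
  ⟨glAct_one_homog, fun h => DiagEnd.mem_of_apply_eq
    (T := (glAct n d 1 : FreeNilp n d →ₗ[ℝ] FreeNilp n d)) (fun _ _ => glAct_one_homog) iSup_homog
    (fun _ (hk : d + 1 ≤ _) => homog_eq_bot hk) h⟩

lemma mem_derDeg_iff_gen {k : ℕ} {δ : Der1 n d} :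
    δ ∈ derDeg n d k ↔ ∀ j, δ (gen n d j) ∈ homog n d (1 + k) := by
  refine ⟨fun h j => h 1 _ (gen_mem_homog j), fun h => ?_⟩
  -- Homogeneity becomes an identity between derivations, which only has to be checked on
  -- generators.
  have key : ⁅glAct n d 1, δ⁆ = (k : ℝ) • δ := by
    apply derivation_ext
    intro j
    have h1 := glAct_one_homog (h j)
    have h2 := glAct_one_homog (gen_mem_homog (n := n) (d := d) j)
    rw [LieDerivation.commutator_apply, h1, h2]
    simp [add_smul]
  intro m y hy
  have := LieDerivation.congr_fun key y
  rw [LieDerivation.commutator_apply, glAct_one_homog hy] at this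
  rw [mem_homog, eq_add_of_sub_eq this]
  simp [add_smul, add_comm]

lemma mem_derDeg {k : ℕ} {δ : Der1 n d} :
    δ ∈ derDeg n d k ↔ ⁅glAct n d 1, δ⁆ = (k : ℝ) • δ := by
  constructor
  · intro h
    apply derivation_ext
    intro j
    have h1 := glAct_one_homog (h 1 _ (gen_mem_homog j))
    have h2 := glAct_one_homog (gen_mem_homog (n := n) (d := d) j)
    rw [LieDerivation.commutator_apply, h1, h2]
    simp [add_smul]
  · intro h
    rw [mem_derDeg_iff_gen]
    intro j
    have := LieDerivation.congr_fun h (gen n d j)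
    rw [LieDerivation.commutator_apply, glAct_one_homog (gen_mem_homog j)] at this
    rw [mem_homog, eq_add_of_sub_eq this]
    simp [add_smul, add_comm]

lemma derDeg_eq_bot {k : ℕ} (hk : d ≤ k) : derDeg n d k = ⊥ := by
  rw [eq_bot_iff]
  intro δ hδ
  rw [Submodule.mem_bot]
  apply derivation_ext
  intro j
  have := hδ 1 _ (gen_mem_homog j)
  rw [homog_eq_bot (by omega), Submodule.mem_bot] at this
  simpa using this

/-- A derivation is a sum of derivations that move a single generator, and each of these splits
according to the homogeneous parts of that value. -/
lemma iSup_derDeg : ⨆ k, derDeg n d k = ⊤ := by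
  rw [eq_top_iff]
  rintro δ -
  rw [← (evalGen n d).symm_apply_apply δ, ← Finset.univ_sum_single (evalGen n d δ), map_sum]
  refine Submodule.sum_mem _ fun j _ => ?_
  generalize evalGen n d δ j = y
  have hy : y ∈ ⨆ k, homog n d k := iSup_homog ▸ Submodule.mem_top
  induction hy using Submodule.iSup_induction' with
  | mem m x hx =>
    rcases m with - | m
    · rw [homog_zero, Submodule.mem_bot] at hx
      simp [hx]
    · refine Submodule.mem_iSup_of_mem m (mem_derDeg_iff_gen.2 fun i => ?_)
      rw [evalGen_symm_gen]
      rcases eq_or_ne i j with rfl | h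
      · rwa [Pi.single_eq_same, add_comm]
      · rw [Pi.single_eq_of_ne h]
        exact zero_mem _
  | zero => simp
  | add x y _ _ hx hy => rw [Pi.single_add, map_add]; exact add_mem hx hy

lemma iSupIndep_derDeg : iSupIndep (derDeg n d) := by
  have h := (Module.End.eigenspaces_iSupIndep
    (LieAlgebra.ad ℝ (Der1 n d) (glAct n d 1))).comp (Nat.cast_injective (R := ℝ))
  convert h using 1
  ext k δ
  rw [mem_derDeg, Function.comp_apply, Module.End.mem_eigenspace_iff, LieAlgebra.ad_apply]

lemma derDeg_le_UL {k : ℕ} (hk : 1 ≤ k) : derDeg n d k ≤ UL n d := by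
  by_cases h : k < d
  · exact le_biSup (derDeg n d) (show k ∈ Finset.Icc 1 (d - 1) by simp; omega)
  · simp [derDeg_eq_bot (not_lt.1 h)]

lemma isInternal_derDeg : DirectSum.IsInternal (fun k : Fin d => derDeg n d (k : ℕ)) := by
  refine DirectSum.isInternal_submodule_of_iSupIndep_of_iSup_eq_top
    (iSupIndep_derDeg.comp Fin.val_injective) ?_
  rw [eq_top_iff, ← iSup_derDeg]
  refine iSup_le fun k => ?_
  by_cases h : k < d
  · exact le_iSup (fun k : Fin d => derDeg n d (k : ℕ)) ⟨k, h⟩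
  · simp [derDeg_eq_bot (not_lt.1 h)]

lemma isCompl_derDeg_zero : IsCompl (derDeg n d 0) (UL n d) := by
  constructor
  · refine (iSupIndep_derDeg (n := n) (d := d) 0).mono_right ?_
    refine iSup₂_le fun k hk => le_iSup₂_of_le k ?_ le_rfl
    simp at hk
    omega
  · rw [codisjoint_iff, eq_top_iff, ← iSup_derDeg]
    refine iSup_le fun k => ?_
    rcases k with - | k
    · exact le_sup_left
    · exact (derDeg_le_UL (by omega)).trans le_sup_right

lemma range_glAct : LinearMap.range
    (glAct n d : Matrix (Fin n) (Fin n) ℝ →ₗ[ℝ] Der1 n d) = derDeg n d 0 := by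
  ext δ
  rw [mem_derDeg_iff_gen]
  constructor
  · rintro ⟨A, rfl⟩ j
    rw [add_zero, mem_homog_one]
    exact ⟨fun i => A i j, glAct_gen A j⟩
  · intro h
    simp_rw [add_zero, mem_homog_one] at h
    choose c hc using h
    refine ⟨fun i j => c j i, derivation_ext fun j => ?_⟩
    rw [hc]
    exact glAct_gen _ j

lemma lie_mem_derDeg {a b : ℕ} {x y : Der1 n d} (hx : x ∈ derDeg n d a) (hy : y ∈ derDeg n d b) :
    ⁅x, y⁆ ∈ derDeg n d (a + b) := by
  rw [mem_derDeg] at *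
  rw [leibniz_lie, hx, hy]
  simp [add_smul]

/-! ### Embedding in the free associative algebra; the centre of `L[V,d]` -/

/-- The free associative algebra on `n` generators, with the words as a basis. -/
abbrev Words (n : ℕ) : Type := MonoidAlgebra ℝ (FreeMonoid (Fin n))

/-- The span of the words whose length satisfies `p`. -/
def lengthSpan (n : ℕ) (p : ℕ → Prop) : Submodule ℝ (Words n) :=
  Submodule.span ℝ {a | ∃ w : FreeMonoid (Fin n), p w.length ∧ a = MonoidAlgebra.single w 1}

lemma lie_mem_lengthSpan {p q r : ℕ → Prop} (h : ∀ i j, p i → q j → r (i + j)) {x y : Words n}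
    (hx : x ∈ lengthSpan n p) (hy : y ∈ lengthSpan n q) : ⁅x, y⁆ ∈ lengthSpan n r := by
  refine LieAlgebra.lie_mem_of_mem_span ?_ hx hy
  rintro _ ⟨u, hu, rfl⟩ _ ⟨v, hv, rfl⟩
  rw [Ring.lie_def, MonoidAlgebra.single_mul_single, MonoidAlgebra.single_mul_single, mul_one]
  refine sub_mem (Submodule.subset_span ⟨_, ?_, rfl⟩) (Submodule.subset_span ⟨_, ?_, rfl⟩)
  · rw [FreeMonoid.length_mul]
    exact h _ _ hu hv
  · rw [FreeMonoid.length_mul, add_comm]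
    exact h _ _ hu hv

lemma length_of_coeff_ne_zero {p : ℕ → Prop} {x : Words n} (hx : x ∈ lengthSpan n p)
    {w : FreeMonoid (Fin n)} (hw : x.coeff w ≠ 0) : p w.length := by
  induction hx using Submodule.span_induction with
  | mem x hx =>
    obtain ⟨u, hu, rfl⟩ := hx
    obtain rfl : u = w := by
      by_contra h
      exact hw (by rw [MonoidAlgebra.coeff_single]; exact Finsupp.single_eq_of_ne' h)
    exact hu
  | zero => simp at hw
  | add x y _ _ hx hy =>
    by_cases h : x.coeff w = 0
    · exact hy (by simpa [h] using hw)
    · exact hx h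
  | smul c x _ hx => exact hx fun h => hw (by simp [h])

/-- The canonical map from the free Lie algebra to the free associative algebra. -/
def toWords (n : ℕ) : FreeLieAlgebra ℝ (Fin n) →ₗ⁅ℝ⁆ Words n :=
  FreeLieAlgebra.lift ℝ fun i => MonoidAlgebra.single (FreeMonoid.of i) 1

lemma toWords_of (i : Fin n) : toWords n (FreeLieAlgebra.of ℝ i) =
    MonoidAlgebra.single (FreeMonoid.of i) 1 := by simp [toWords]

lemma toWords_mem_of_mem_lowerCentralSeries (k : ℕ) {a : FreeLieAlgebra ℝ (Fin n)}
    (ha : a ∈ LieModule.lowerCentralSeries ℝ (FreeLieAlgebra ℝ (Fin n))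
      (FreeLieAlgebra ℝ (Fin n)) k) : toWords n a ∈ lengthSpan n (k + 1 ≤ ·) := by
  have pos (a) : toWords n a ∈ lengthSpan n (1 ≤ ·) := by
    induction a using FreeLieAlgebra.induction_lie with
    | of i => exact Submodule.subset_span ⟨.of i, by simp, toWords_of i⟩
    | zero => simp
    | add a b ha hb => rw [map_add]; exact add_mem ha hb
    | smul c a ha => rw [map_smul]; exact Submodule.smul_mem _ c ha
    | lie a b ha hb =>
      rw [LieHom.map_lie]
      exact lie_mem_lengthSpan (fun i j hi _ => by omega) ha hb
  induction k generalizing a with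
  | zero => simpa using pos a
  | succ k ih =>
    rw [LieModule.lowerCentralSeries_succ, ← LieSubmodule.mem_toSubmodule,
      LieSubmodule.lieIdeal_oper_eq_linear_span'] at ha
    induction ha using Submodule.span_induction with
    | mem x hx =>
      obtain ⟨u, -, v, hv, rfl⟩ := hx
      rw [LieHom.map_lie]
      exact lie_mem_lengthSpan (fun i j hi hj => by omega) (pos u) (ih hv)
    | zero => simp
    | add x y _ _ hx hy => rw [map_add]; exact add_mem hx hy
    | smul c x _ hx => rw [map_smul]; exact Submodule.smul_mem _ c hx

lemma exists_lift_of_mem_homog {k : ℕ} {y : FreeNilp n d} (hy : y ∈ homog n d k) :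
    ∃ a, proj n d a = y ∧ toWords n a ∈ lengthSpan n (· = k) := by
  induction hy using Submodule.span_induction with
  | mem x hx =>
    obtain ⟨w, rfl, rfl⟩ := hx
    induction w using FreeMagma.rec with
    | of i => exact ⟨.of ℝ i, rfl, Submodule.subset_span ⟨.of i, by simp [FreeMagma.length],
        toWords_of i⟩⟩
    | mul u v hu hv =>
      obtain ⟨a, ha, ha'⟩ := hu
      obtain ⟨b, hb, hb'⟩ := hv
      refine ⟨⁅a, b⁆, by simp [ha, hb, bracketWord], ?_⟩
      rw [LieHom.map_lie]
      exact lie_mem_lengthSpan (fun i j hi hj => by simp [FreeMagma.length, hi, hj]) ha' hb'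
  | zero => exact ⟨0, by simp⟩
  | add x y _ _ hx hy =>
    obtain ⟨a, rfl, ha⟩ := hx
    obtain ⟨b, rfl, hb⟩ := hy
    exact ⟨a + b, map_add _ _ _, by rw [map_add]; exact add_mem ha hb⟩
  | smul c x _ hx =>
    obtain ⟨a, rfl, ha⟩ := hx
    exact ⟨c • a, map_smul _ _ _, by rw [map_smul]; exact Submodule.smul_mem _ c ha⟩

/-- The action of `z ∈ L` on `L ⋊ ℝE`, where `E` is the derivation with `E x_i = x_i`. -/
def eulerRep (z : FreeNilp n d) : Module.End ℝ (FreeNilp n d × ℝ) where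
  toFun p := (⁅z, p.1⁆ + p.2 • glAct n d 1 z, 0)
  map_add' p q := by ext <;> simp [add_smul]; abel
  map_smul' c p := by ext <;> simp [mul_smul]

/-- The operators `eulerRep` define a representation of the free associative algebra in which
`toWords n a` acts as `proj n d a`. On `(0, 1)` this action gives `E (proj n d a)`. The adjoined
line is essential: on `L` alone central elements act as zero. -/
lemma eq_zero_of_toWords_eq_zero {a : FreeLieAlgebra ℝ (Fin n)} (ha : toWords n a = 0) :
    glAct n d 1 (proj n d a) = 0 := by
  let θ : Words n →ₐ[ℝ] Module.End ℝ (FreeNilp n d × ℝ) :=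
    MonoidAlgebra.lift ℝ _ _ (FreeMonoid.lift fun i => eulerRep (gen n d i))
  have key (a) : θ (toWords n a) = eulerRep (proj n d a) := by
    induction a using FreeLieAlgebra.induction_lie with
    | of i => simp [θ, toWords_of, gen]
    | zero => ext <;> simp [eulerRep]
    | add a b ha hb =>
      rw [map_add, map_add, ha, hb]
      ext <;> simp [eulerRep]
    | smul c a ha =>
      rw [map_smul, map_smul, ha]
      ext <;> simp [eulerRep]
    | lie a b ha hb =>
      rw [LieHom.map_lie, LieHom.map_lie, Ring.lie_def, map_sub, map_mul, map_mul, ha, hb]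
      ext p
      · simp [eulerRep]
      · simp [eulerRep]
      · simp only [eulerRep, LinearMap.comp_apply, LinearMap.sub_apply, Module.End.mul_apply,
          LinearMap.coe_mk, AddHom.coe_mk, LinearMap.inr_apply, lie_zero, zero_add, one_smul,
          zero_smul, add_zero, Prod.fst_sub]
        rw [LieDerivation.apply_lie_eq_sub]
      · simp [eulerRep]
  have := congrArg Prod.fst (LinearMap.congr_fun (key a) (0, 1))
  simpa [ha, eulerRep] using this.symm

/-- The centre of `L[V,d]` lies in degree `d`. -/
lemma eq_zero_of_lie_gen_eq_zero (hn : 2 ≤ n) {m : ℕ} (hm : m < d) {y : FreeNilp n d}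
    (hy : y ∈ homog n d m) (h : ∀ i, ⁅gen n d i, y⁆ = 0) : y = 0 := by
  rcases m.eq_zero_or_pos with rfl | hpos
  · simpa [homog_zero] using hy
  obtain ⟨a, rfl, ha⟩ := exists_lift_of_mem_homog hy
  have comm (i : Fin n) : ⁅(MonoidAlgebra.single (FreeMonoid.of i) 1 : Words n), toWords n a⁆ = 0 := by
    rw [← toWords_of, ← LieHom.map_lie]
    have h1 : toWords n ⁅FreeLieAlgebra.of ℝ i, a⁆ ∈ lengthSpan n (d + 1 ≤ ·) :=
      toWords_mem_of_mem_lowerCentralSeries d (proj_eq_zero_iff.1 (by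
        rw [LieHom.map_lie]; exact h i))
    have h2 : toWords n ⁅FreeLieAlgebra.of ℝ i, a⁆ ∈ lengthSpan n (· = 1 + m) := by
      rw [LieHom.map_lie]
      refine lie_mem_lengthSpan (p := (· = 1)) (q := (· = m)) (by omega) ?_ ha
      exact Submodule.subset_span ⟨.of i, by simp, toWords_of i⟩
    -- The bracket has degree `1 + m ≤ d`, whereas it lies in the span of words of length at least
    -- `d + 1`.
    ext w
    by_contra hw
    have := length_of_coeff_ne_zero h1 hw
    have := length_of_coeff_ne_zero h2 hw
    omega
  have hzero : toWords n a = 0 := by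
    ext w
    by_contra hw
    have hlen := length_of_coeff_ne_zero ha hw
    obtain ⟨i, v, rfl⟩ : ∃ i v, w = FreeMonoid.of i * v := by
      cases w using FreeMonoid.casesOn with
      | one => simp at hlen; omega
      | of_mul i v => exact ⟨i, v, rfl⟩
    -- If `x_i v` occurs in `a` and `k ≠ i`, then `x_i v x_k` occurs in `a x_k` with the same
    -- coefficient but not in `x_k a`.
    have : Nontrivial (Fin n) := Fin.nontrivial_iff_two_le.2 hn
    obtain ⟨k, hk⟩ := exists_ne i
    have h1 := congrArg (fun x => x.coeff (FreeMonoid.of i * v * FreeMonoid.of k)) (comm k)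
    simp only [Ring.lie_def, MonoidAlgebra.coeff_sub, Finsupp.sub_apply,
      MonoidAlgebra.coeff_zero, Finsupp.zero_apply] at h1
    rw [MonoidAlgebra.coeff_single_mul_of_forall_mul_ne,
      MonoidAlgebra.coeff_mul_single_eq_coeff_mul (FreeMonoid.of i * v)] at h1
    · simp at h1 hw
      exact hw h1
    · intro u _
      exact mul_left_inj _
    · intro u hu
      rw [mul_assoc] at hu
      have := congrArg FreeMonoid.toList hu
      simp at this
      exact hk this.1
  have := eq_zero_of_toWords_eq_zero (d := d) hzero
  rw [glAct_one_homog hy] at this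
  exact (smul_eq_zero.1 this).resolve_left (by positivity)

/-- Letters are independent words of length 1, and the relations of `L[V,d]` only involve words of
length at least `d + 1`. -/
lemma linearIndependent_gen (hd : 1 ≤ d) : LinearIndependent ℝ (gen n d) := by
  rw [Fintype.linearIndependent_iff]
  intro c hc k
  by_contra hk
  have h0 : proj n d (∑ i, c i • .of ℝ i) = 0 := by
    rw [← hc, map_sum]
    exact Finset.sum_congr rfl fun i _ => map_smul _ _ _
  have h1 := toWords_mem_of_mem_lowerCentralSeries d (proj_eq_zero_iff.1 h0)
  have h2 : (toWords n (∑ i, c i • .of ℝ i)).coeff (FreeMonoid.of k) = c k := by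
    simp only [map_sum, map_smul, toWords_of, MonoidAlgebra.coeff_sum, Finsupp.finsetSum_apply,
      MonoidAlgebra.coeff_smul, MonoidAlgebra.coeff_single, Finsupp.smul_apply]
    rw [Finset.sum_eq_single k]
    · simp
    · intro i _ hi
      rw [Finsupp.single_eq_of_ne' (fun h => hi (FreeMonoid.of_injective h)), smul_zero]
    · simp
  have := length_of_coeff_ne_zero h1 (w := .of k) (by rwa [h2])
  simp at this
  omega

lemma glAct_injective (hd : 1 ≤ d) : Function.Injective (glAct n d) := by
  rw [injective_iff_map_eq_zero]
  intro A hA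
  ext i j
  have := glAct_gen (d := d) A j
  rw [hA, LieDerivation.zero_apply] at this
  exact Fintype.linearIndependent_iff.1 (linearIndependent_gen hd) _ this.symm i

end FreeNilp

/-! ### Derivations of `𝔤𝔩` -/

namespace Matrix

variable {ι : Type*} [Fintype ι] [DecidableEq ι]

lemma mul_single_one_eq_sum (x : Matrix ι ι ℝ) (i j : ι) :
    x * single i j 1 = ∑ k, x k i • single k j (1 : ℝ) := by
  ext a b
  simp [Matrix.mul_apply, Matrix.sum_apply, single_apply, ite_and]

lemma single_one_mul_eq_sum (x : Matrix ι ι ℝ) (i j : ι) :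
    single i j 1 * x = ∑ l, x j l • single i l (1 : ℝ) := by
  ext a b
  simp [Matrix.mul_apply, Matrix.sum_apply, single_apply, ite_and]

/-- Invariance of the Casimir tensor `∑ E_ij ⊗ E_ji` under `ad x`, evaluated by a bilinear map. -/
lemma sum_lie_single_add_eq_zero {N : Type*} [AddCommGroup N] [Module ℝ N]
    (f : Matrix ι ι ℝ →ₗ[ℝ] Matrix ι ι ℝ →ₗ[ℝ] N) (x : Matrix ι ι ℝ) :
    ∑ i, ∑ j, (f ⁅x, single i j (1 : ℝ)⁆ (single j i 1) +
      f (single i j (1 : ℝ)) ⁅x, single j i (1 : ℝ)⁆) = 0 := by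
  simp only [Ring.lie_def, mul_single_one_eq_sum, single_one_mul_eq_sum, map_sub, map_sum,
    LinearMap.sub_apply, LinearMap.sum_apply, map_smul, LinearMap.smul_apply,
    Finset.sum_add_distrib, Finset.sum_sub_distrib]
  have h1 : ∑ i, ∑ j, ∑ k, x k i • f (single k j (1 : ℝ)) (single j i 1) =
      ∑ i, ∑ j, ∑ l, x i l • f (single i j (1 : ℝ)) (single j l 1) :=
    (Finset.sum_comm.trans (Finset.sum_congr rfl fun j _ => Finset.sum_comm)).trans
      Finset.sum_comm
  have h2 : ∑ i, ∑ j, ∑ l, x j l • f (single i l (1 : ℝ)) (single j i 1) =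
      ∑ i, ∑ j, ∑ k, x k j • f (single i j (1 : ℝ)) (single k i 1) :=
    Finset.sum_congr rfl fun i _ => Finset.sum_comm
  rw [h1, h2]
  abel

/-- The Casimir operator of the adjoint representation; it is the scalar `2n` on traceless matrices,
`n` being the size. -/
lemma sum_lie_lie_single (y : Matrix ι ι ℝ) :
    ∑ i, ∑ j, ⁅⁅y, single i j (1 : ℝ)⁆, single j i (1 : ℝ)⁆ =
      (2 * Fintype.card ι : ℝ) • y - (2 * y.trace) • 1 := by
  have h (i j : ι) : ⁅⁅y, single i j (1 : ℝ)⁆, single j i (1 : ℝ)⁆ =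
      y * single i i 1 - single i i (y j j) - (single j j (y i i) - single j j 1 * y) := by
    rw [Ring.lie_def, Ring.lie_def, sub_mul, mul_sub, mul_assoc, single_mul_single_same,
      single_mul_mul_single, ← mul_assoc, single_mul_mul_single, ← mul_assoc,
      single_mul_single_same]
    simp
  have h1 : ∑ i : ι, single i i (1 : ℝ) = 1 := sum_single_one
  have h2 (c : ℝ) : ∑ i : ι, single i i c = c • 1 := by
    rw [← h1, Finset.smul_sum]
    simp
  have h3 : ∑ i, ∑ j, single i i (y j j) = y.trace • (1 : Matrix ι ι ℝ) := by
    rw [Finset.sum_comm, trace, Finset.sum_smul]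
    exact Finset.sum_congr rfl fun j _ => h2 _
  have h4 : ∑ i, ∑ j, single j j (y i i) = y.trace • (1 : Matrix ι ι ℝ) := by
    rw [Finset.sum_comm]
    exact h3
  simp_rw [h, Finset.sum_sub_distrib]
  rw [h3, h4]
  simp only [Finset.sum_const, ← Finset.smul_sum, ← Finset.mul_sum, ← Finset.sum_mul, h1]
  simp only [Finset.card_univ, mul_one, one_mul, ← Nat.cast_smul_eq_nsmul ℝ]
  module

/-- `𝔤𝔩` is spanned by the commutators and the identity matrix. -/
lemma eq_top_of_lie_mem [Nonempty ι] {S : Submodule ℝ (Matrix ι ι ℝ)}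
    (h : ∀ A B : Matrix ι ι ℝ, ⁅A, B⁆ ∈ S) (h1 : 1 ∈ S) : S = ⊤ := by
  have hne (i j : ι) (hij : i ≠ j) : single i j (1 : ℝ) ∈ S := by
    simpa [Ring.lie_def, hij.symm, single_mul_single_same, single_mul_single_of_ne]
      using h (single i i 1) (single i j 1)
  have hsub (i j : ι) : single i i (1 : ℝ) - single j j 1 ∈ S := by
    simpa [Ring.lie_def, single_mul_single_same] using h (single i j 1) (single j i 1)
  have hdiag (i : ι) : single i i (1 : ℝ) ∈ S := by
    -- `∑ j, (E_ii - E_jj) + 1` is the size of the matrices times `E_ii`.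
    have := add_mem (sum_mem fun j (_ : j ∈ Finset.univ) => hsub i j) h1
    rw [Finset.sum_sub_distrib, sum_single_one, sub_add_cancel, Finset.sum_const,
      Finset.card_univ, ← Nat.cast_smul_eq_nsmul ℝ] at this
    have := S.smul_mem (Fintype.card ι : ℝ)⁻¹ this
    rwa [smul_smul, inv_mul_cancel₀ (by positivity), one_smul] at this
  rw [eq_top_iff]
  rintro A -
  rw [matrix_eq_sum_single A]
  refine sum_mem fun i _ => sum_mem fun j _ => ?_
  rw [show single i j (A i j) = A i j • single i j 1 by simp]
  refine S.smul_mem _ ?_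
  rcases eq_or_ne i j with rfl | hij
  · exact hdiag i
  · exact hne i j hij

/-- A derivation of `𝔤𝔩` which vanishes on the identity matrix is inner. -/
lemma exists_eq_lie_of_derivation [Nonempty ι] (D : Matrix ι ι ℝ →ₗ[ℝ] Matrix ι ι ℝ)
    (hD : ∀ A B, D ⁅A, B⁆ = ⁅D A, B⁆ + ⁅A, D B⁆) (h1 : D 1 = 0) : ∃ T : Matrix ι ι ℝ, ∀ A, D A = ⁅T, A⁆ := by
  have hc : (2 * Fintype.card ι : ℝ) ≠ 0 := by positivity
  -- `trace ∘ D` vanishes on commutators and on the identity. Tracelessness makes the Casimir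
  -- operator scalar on the values of `D`.
  have htr : ∀ A, (D A).trace = 0 := by
    let τ : Matrix ι ι ℝ →ₗ[ℝ] ℝ := traceLinearMap ι ℝ ℝ ∘ₗ D
    have hτ : LinearMap.ker τ = ⊤ := by
      refine eq_top_of_lie_mem (fun A B => ?_) (by simp [τ, h1])
      change (D ⁅A, B⁆).trace = 0
      rw [hD, Ring.lie_def, Ring.lie_def, trace_add, trace_sub, trace_sub, trace_mul_comm (D A),
        trace_mul_comm A]
      ring
    exact fun A => hτ.ge (Submodule.mem_top (x := A))
  -- Casimir invariance for `(X, Y) ↦ [D X, Y]` reads `2n D A + [A, ∑ [D E_ij, E_ji]] = 0`, which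
  -- dictates the witness.
  refine ⟨(2 * Fintype.card ι : ℝ)⁻¹ • ∑ i, ∑ j, ⁅D (single i j 1), single j i (1 : ℝ)⁆,
    fun A => ?_⟩
  let f : Matrix ι ι ℝ →ₗ[ℝ] Matrix ι ι ℝ →ₗ[ℝ] Matrix ι ι ℝ :=
    (LieModule.toEnd ℝ (Matrix ι ι ℝ) (Matrix ι ι ℝ)).toLinearMap ∘ₗ D
  have hf (X Y) : f X Y = ⁅D X, Y⁆ := rfl
  have key := sum_lie_single_add_eq_zero f A
  have e : ∀ i j, f ⁅A, single i j (1 : ℝ)⁆ (single j i 1) +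
      f (single i j (1 : ℝ)) ⁅A, single j i (1 : ℝ)⁆ =
      ⁅⁅D A, single i j (1 : ℝ)⁆, single j i (1 : ℝ)⁆ +
        ⁅A, ⁅D (single i j 1), single j i (1 : ℝ)⁆⁆ := by
    intro i j
    rw [hf, hf, hD, add_lie, leibniz_lie A]
    abel
  simp_rw [e, Finset.sum_add_distrib, ← lie_sum] at key
  rw [sum_lie_lie_single, htr, mul_zero, zero_smul, sub_zero] at key
  rw [smul_lie, ← lie_skew, ← eq_neg_of_add_eq_zero_left key, smul_smul, inv_mul_cancel₀ hc,
    one_smul]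

end Matrix

namespace FreeNilp

variable {n d : ℕ}

/-! ### The centre of `D¹ L` -/

lemma ad_mem_derDeg {k : ℕ} {y : FreeNilp n d} (hy : y ∈ homog n d k) :
    LieDerivation.ad ℝ (FreeNilp n d) y ∈ derDeg n d k := by
  intro m z hz
  rw [LieDerivation.ad_apply_apply, add_comm]
  exact lie_mem_homog hy hz

lemma eq_zero_of_ad_eq_zero (hn : 2 ≤ n) {m : ℕ} (hm : m < d) {y : FreeNilp n d}
    (hy : y ∈ homog n d m) (h : LieDerivation.ad ℝ (FreeNilp n d) y = 0) : y = 0 := by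
  refine eq_zero_of_lie_gen_eq_zero hn hm hy fun i => ?_
  rw [← lie_skew, ← LieDerivation.ad_apply_apply ℝ, h, LieDerivation.zero_apply, neg_zero]

/-- Commuting with `E` gives degree 0, and commuting with `ad x_j` gives `ad (δ x_j) = 0` with `δ
x_j` in degree `1 < d`. -/
lemma der_eq_zero_of_central (hn : 2 ≤ n) (hd : 2 ≤ d) {δ : Der1 n d} (h : ∀ u : Der1 n d, ⁅δ, u⁆ = 0) :
    δ = 0 := by
  have h0 : δ ∈ derDeg n d 0 := by
    rw [mem_derDeg, ← lie_skew, h]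
    simp
  apply derivation_ext
  intro j
  refine eq_zero_of_ad_eq_zero hn (m := 1) (by omega) (h0 1 _ (gen_mem_homog j)) ?_
  rw [← LieDerivation.lie_der_ad_eq_ad_der, h]

lemma ad_injective (hn : 2 ≤ n) (hd : 2 ≤ d) :
    Function.Injective (LieDerivation.ad ℝ (Der1 n d)) := by
  rw [injective_iff_map_eq_zero]
  intro δ hδ
  refine der_eq_zero_of_central hn hd fun u => ?_
  rw [← LieDerivation.ad_apply_apply ℝ, hδ, LieDerivation.zero_apply]

lemma derDeg_induction {p : Der1 n d → Prop} (h : ∀ k, ∀ u ∈ derDeg n d k, p u) (h0 : p 0)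
    (hadd : ∀ u v, p u → p v → p (u + v)) (u : Der1 n d) : p u := by
  have hu : u ∈ ⨆ k, derDeg n d k := iSup_derDeg ▸ Submodule.mem_top
  exact Submodule.iSup_induction (motive := p) _ hu h h0 hadd

/-! ### Derivations of `D¹ L` -/

/-- Bracketing with `E` is invertible in each positive degree. -/
lemma exists_sub_lie_mem (y : Der1 n d) : ∃ x : Der1 n d, y - ⁅x, glAct n d 1⁆ ∈ derDeg n d 0 := by
  induction y using derDeg_induction with
  | h k u hu =>
    rcases k with - | k
    · exact ⟨0, by simpa⟩
    · refine ⟨-((k + 1 : ℕ) : ℝ)⁻¹ • u, ?_⟩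
      rw [smul_lie, ← lie_skew, mem_derDeg.1 hu, smul_neg, neg_smul, neg_neg, smul_smul,
        inv_mul_cancel₀ (by positivity), one_smul, sub_self]
      exact zero_mem _
  | h0 => exact ⟨0, by simp⟩
  | hadd u v hu hv =>
    obtain ⟨x, hx⟩ := hu
    obtain ⟨x', hx'⟩ := hv
    refine ⟨x + x', ?_⟩
    rw [add_lie, add_sub_add_comm]
    exact add_mem hx hx'

lemma mem_derDeg_of_lie_sub {k : ℕ} {u : Der1 n d}
    (h : ⁅glAct n d 1, u⁆ - (k : ℝ) • u ∈ derDeg n d k) : u ∈ derDeg n d k := by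
  rw [mem_derDeg] at *
  exact DiagEnd.sub_apply_eq_zero (T := LieAlgebra.ad ℝ (Der1 n d) (glAct n d 1))
    (fun _ _ hy => mem_derDeg.1 hy) iSup_derDeg (fun _ hk => derDeg_eq_bot hk) h

/-- Applying `D` to `[E, u] = k u` gives `[E, D u] - k D u = -[D E, u]`, of degree `k`. Without
Jordan blocks `D u` itself has degree `k`, so `[D E, u] = 0` and `D E` is central. -/
lemma degree_zero_of_apply_mem (hn : 2 ≤ n) (hd : 2 ≤ d) {D : Der2 n d}
    (hD : D (glAct n d 1) ∈ derDeg n d 0) :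
    D (glAct n d 1) = 0 ∧ ∀ k, ∀ u ∈ derDeg n d k, D u ∈ derDeg n d k := by
  have h1 : ∀ k, ∀ u ∈ derDeg n d k, D u ∈ derDeg n d k ∧ ⁅D (glAct n d 1), u⁆ = 0 := by
    intro k u hu
    have h2 := D.apply_lie_eq_add (glAct n d 1) u
    rw [mem_derDeg.1 hu, map_smul] at h2
    have h3 : D u ∈ derDeg n d k := by
      apply mem_derDeg_of_lie_sub
      rw [h2, sub_add_cancel_left]
      simpa using neg_mem (lie_mem_derDeg hD hu)
    refine ⟨h3, ?_⟩
    rwa [mem_derDeg.1 h3, left_eq_add] at h2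
  refine ⟨der_eq_zero_of_central hn hd fun u => ?_, fun k u hu => (h1 k u hu).1⟩
  induction u using derDeg_induction with
  | h k u hu => exact (h1 k u hu).2
  | h0 => simp
  | hadd u v hu hv => rw [lie_add, hu, hv, add_zero]

lemma exists_apply_glAct_eq (hn : 2 ≤ n) (hd : 2 ≤ d) {D : Der2 n d}
    (hD : D (glAct n d 1) = 0) :
    ∃ T, ∀ A, D (glAct n d A) = ⁅glAct n d T, glAct n d A⁆ := by
  have inj := glAct_injective (n := n) (d := d) (by omega)
  have h1 := (degree_zero_of_apply_mem hn hd (hD ▸ zero_mem _ : D (glAct n d 1) ∈ _)).2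
  have h2 : ∀ A, ∃ B, glAct n d B = D (glAct n d A) := by
    intro A
    have hA : glAct n d A ∈ derDeg n d 0 := range_glAct.le ⟨A, rfl⟩
    exact range_glAct.ge (h1 0 _ hA)
  choose f hf using h2
  let F : Matrix (Fin n) (Fin n) ℝ →ₗ[ℝ] Matrix (Fin n) (Fin n) ℝ :=
    { toFun := f
      map_add' := fun A B => inj (by simp [hf])
      map_smul' := fun c A => inj (by simp [hf]) }
  have : Nonempty (Fin n) := ⟨⟨0, by omega⟩⟩
  obtain ⟨T, hT⟩ := Matrix.exists_eq_lie_of_derivation F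
    (fun A B => inj (by
      change glAct n d (f _) = glAct n d (⁅f _, _⁆ + ⁅_, f _⁆)
      rw [map_add, hf, LieHom.map_lie, LieHom.map_lie, LieHom.map_lie, hf, hf,
        D.apply_lie_eq_add, add_comm]))
    (inj (by change glAct n d (f _) = _; rw [hf, hD, map_zero]))
  refine ⟨T, fun A => ?_⟩
  rw [← hf, ← LieHom.map_lie, ← hT]
  rfl

lemma lie_gen_mem_homog (a b : Fin n) : ⁅gen n d a, gen n d b⁆ ∈ homog n d 2 :=
  Submodule.subset_span ⟨.mul (.of a) (.of b), rfl, rfl⟩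

lemma homog_two_induction {p : (z : FreeNilp n d) → z ∈ homog n d 2 → Prop}
    (lie : ∀ a b, p ⁅gen n d a, gen n d b⁆ (lie_gen_mem_homog a b))
    (zero : p 0 (zero_mem _))
    (add : ∀ u v hu hv, p u hu → p v hv → p (u + v) (add_mem hu hv))
    (smul : ∀ (c : ℝ) u hu, p u hu → p (c • u) (Submodule.smul_mem _ c hu))
    {z : FreeNilp n d} (hz : z ∈ homog n d 2) : p z hz := by
  let S : Submodule ℝ (FreeNilp n d) :=
    { carrier := {z | ∃ hz, p z hz}
      zero_mem' := ⟨_, zero⟩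
      add_mem' := fun {u v} ⟨hu, hu'⟩ ⟨hv, hv'⟩ => ⟨add_mem hu hv, add u v hu hv hu' hv'⟩
      smul_mem' := fun c u ⟨hu, hu'⟩ => ⟨Submodule.smul_mem _ c hu, smul c u hu hu'⟩ }
  suffices h : homog n d 2 ≤ S by
    obtain ⟨_, h⟩ := h hz
    exact h
  rw [homog_succ]
  refine Submodule.span_le.2 ?_
  rintro _ ⟨j, y, hy, rfl⟩
  refine LieAlgebra.lie_mem_of_mem_span (N := S) ?_
    (Submodule.subset_span (Set.mem_range_self (f := gen n d) j)) hy
  rintro _ ⟨a, rfl⟩ _ ⟨b, rfl⟩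
  exact ⟨_, lie a b⟩

/-- The `𝔤𝔩`-equivariant bilinear maps `V × V → L^{(2)}` are the multiples of the bracket. -/
lemma exists_eq_smul_lie_gen (hn : 2 ≤ n) {b : Fin n → Fin n → FreeNilp n d}
    (hb : ∀ i j, b i j ∈ homog n d 2)
    (h : ∀ k l i j, glAct n d (Matrix.single k l 1) (b i j) =
      (if l = j then b i k else 0) + (if l = i then b k j else 0)) :
    ∃ c : ℝ, ∀ i j, b i j = c • ⁅gen n d i, gen n d j⁆ := by
  -- `E_jj` is idempotent on `L^{(2)}`, since `[x_j, x_j] = 0`, but acts on `b j j` by 2.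
  have hdiag : ∀ j, b j j = 0 := by
    intro j
    have h1 : ∀ z ∈ homog n d 2, glAct n d (Matrix.single j j 1)
        (glAct n d (Matrix.single j j 1) z) = glAct n d (Matrix.single j j 1) z := by
      intro z hz
      induction hz using homog_two_induction with
      | lie a b =>
        rcases eq_or_ne j a with rfl | ha <;> rcases eq_or_ne j b with rfl | hb <;>
          simp [-glAct_gen, glAct_single_gen, *]
      | zero => simp
      | add u v _ _ hu hv => simp [hu, hv]
      | smul c u _ hu => simp [hu]
    have h2 := h1 _ (hb j j)
    rw [h, if_pos rfl, map_add, h, if_pos rfl] at h2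
    have h3 : (2 : ℝ) • b j j = 0 := by
      rw [← sub_eq_zero] at h2
      rw [← h2]
      module
    simpa using h3
  obtain ⟨p, q, hpq⟩ : ∃ p q : Fin n, p ≠ q :=
    ⟨⟨0, by omega⟩, ⟨1, by omega⟩, by simp⟩
  obtain ⟨c, hc⟩ : ∃ c : ℝ, b p q = c • ⁅gen n d p, gen n d q⁆ := by
    -- `E_pp E_qq` maps `L^{(2)}` into the line of `[x_p, x_q]` and fixes `b p q`.
    have h1 : ∀ z ∈ homog n d 2, ∃ c : ℝ, glAct n d (Matrix.single p p 1)
        (glAct n d (Matrix.single q q 1) z) = c • ⁅gen n d p, gen n d q⁆ := by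
      intro z hz
      induction hz using homog_two_induction with
      | lie a b =>
        have hqp := hpq.symm
        rcases eq_or_ne q a with rfl | ha <;> rcases eq_or_ne q b with rfl | hb
        · exact ⟨0, by simp⟩
        · rcases eq_or_ne p b with rfl | hb'
          · refine ⟨-1, ?_⟩
            simp [-glAct_gen, glAct_single_gen, *]
          · refine ⟨0, ?_⟩
            simp [-glAct_gen, glAct_single_gen, *]
        · rcases eq_or_ne p a with rfl | ha'
          · refine ⟨1, ?_⟩
            simp [-glAct_gen, glAct_single_gen, *]
          · refine ⟨0, ?_⟩
            simp [-glAct_gen, glAct_single_gen, *]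
        · refine ⟨0, ?_⟩
          simp [-glAct_gen, glAct_single_gen, *]
      | zero => exact ⟨0, by simp⟩
      | add u v _ _ hu hv =>
        obtain ⟨c, hc⟩ := hu
        obtain ⟨c', hc'⟩ := hv
        exact ⟨c + c', by rw [map_add, map_add, hc, hc', add_smul]⟩
      | smul a u _ hu =>
        obtain ⟨c, hc⟩ := hu
        exact ⟨a * c, by rw [map_smul, map_smul, hc, mul_smul]⟩
    obtain ⟨c, hc⟩ := h1 _ (hb p q)
    refine ⟨c, ?_⟩
    rw [← hc, h, if_pos rfl, if_neg hpq.symm, add_zero, h, if_neg hpq, if_pos rfl, zero_add]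
  refine ⟨c, ?_⟩
  have symm : ∀ i j, b i j = c • ⁅gen n d i, gen n d j⁆ → b j i = c • ⁅gen n d j, gen n d i⁆ := by
    intro i j hij
    have h1 := h i j j j
    rw [hdiag, map_zero, if_pos rfl, if_pos rfl] at h1
    rw [eq_neg_of_add_eq_zero_left h1.symm, hij, ← lie_skew, smul_neg, neg_neg]
  -- `E_ki` sends `x_i` to `x_k` and kills `x_j`, so it carries the formula from `(i, j)` to `(k,
  -- j)`.
  have move : ∀ i j k, i ≠ j → b i j = c • ⁅gen n d i, gen n d j⁆ →
      b k j = c • ⁅gen n d k, gen n d j⁆ := by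
    intro i j k hij hb
    have h1 := h k i i j
    rw [if_neg hij, if_pos rfl, zero_add, hb, map_smul, LieDerivation.apply_lie_eq_add,
      glAct_single_gen, glAct_single_gen, if_neg hij, if_pos rfl, lie_zero, zero_add] at h1
    exact h1.symm
  intro i j
  by_cases hi : i = q
  · subst hi
    exact symm _ _ (move p i j hpq hc)
  · exact symm _ _ (move q i j (Ne.symm hi) (symm _ _ (move p q i hpq hc)))

lemma ad_gen_mem_adV (j : Fin n) : LieDerivation.ad ℝ (FreeNilp n d) (gen n d j) ∈ adV n d :=
  ⟨_, gen_mem_homog j, rfl⟩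

lemma adV_le {S : Submodule ℝ (Der1 n d)}
    (h : ∀ j, LieDerivation.ad ℝ (FreeNilp n d) (gen n d j) ∈ S) : adV n d ≤ S := by
  rintro _ ⟨y, hy, rfl⟩
  obtain ⟨c, rfl⟩ := mem_homog_one.1 hy
  rw [map_sum]
  refine Submodule.sum_mem _ fun i _ => ?_
  rw [map_smul]
  exact S.smul_mem _ (h i)

lemma adV_le_derDeg : adV n d ≤ derDeg n d 1 :=
  adV_le fun j => ad_mem_derDeg (gen_mem_homog j)

lemma UL_le {S : Submodule ℝ (Der1 n d)} (h : ∀ k, 1 ≤ k → derDeg n d k ≤ S) : UL n d ≤ S :=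
  iSup₂_le fun k hk => h k (Finset.mem_Icc.1 hk).1

/-- `D` vanishes on `𝔤𝔩` and on `ad V`. -/
structure IsOuter (D : Der2 n d) : Prop where
  apply_glAct : ∀ A, D (glAct n d A) = 0
  apply_ad_gen : ∀ j, D (LieDerivation.ad ℝ (FreeNilp n d) (gen n d j)) = 0

/-- Since `D` kills `𝔤𝔩`, the map `(x, y) ↦ D (ad x) y` from `V × V` to `L^{(2)}` is
`𝔤𝔩`-equivariant. -/
lemma exists_smul_ad_gen (hn : 2 ≤ n) (hd : 2 ≤ d) {D : Der2 n d}
    (hD : ∀ A, D (glAct n d A) = 0) :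
    ∃ c : ℝ, ∀ j, D (LieDerivation.ad ℝ (FreeNilp n d) (gen n d j)) =
      c • LieDerivation.ad ℝ (FreeNilp n d) (gen n d j) := by
  have hdeg := (degree_zero_of_apply_mem hn hd (by rw [hD]; exact zero_mem _ :
    D (glAct n d 1) ∈ _)).2
  obtain ⟨c, hc⟩ := exists_eq_smul_lie_gen hn
    (b := fun i j => D (LieDerivation.ad ℝ (FreeNilp n d) (gen n d i)) (gen n d j))
    (fun i j => hdeg 1 _ (ad_mem_derDeg (gen_mem_homog i)) 1 _ (gen_mem_homog j)) (by
      intro k l i j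
      have h1 := D.apply_lie_eq_add (glAct n d (Matrix.single k l 1))
        (LieDerivation.ad ℝ (FreeNilp n d) (gen n d i))
      rw [hD, zero_lie, add_zero, LieDerivation.lie_der_ad_eq_ad_der, glAct_single_gen] at h1
      have h2 := LieDerivation.congr_fun h1 (gen n d j)
      rw [LieDerivation.commutator_apply, glAct_single_gen] at h2
      rw [← sub_add_cancel (glAct n d (Matrix.single k l 1) _), ← h2, add_comm]
      congr 1 <;> split_ifs <;> simp)
  refine ⟨c, fun j => derivation_ext fun i => ?_⟩
  rw [hc, LieDerivation.smul_apply, LieDerivation.ad_apply_apply]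

/-- Every derivation of `D¹ L` is, up to an inner one, zero on `𝔤𝔩` and on `ad V`. -/
lemma exists_isOuter_sub_ad (hn : 2 ≤ n) (hd : 2 ≤ d) (D : Der2 n d) :
    ∃ x, IsOuter (D - LieDerivation.ad ℝ (Der1 n d) x) := by
  obtain ⟨x, hx⟩ := exists_sub_lie_mem (D (glAct n d 1))
  have h1 := (degree_zero_of_apply_mem hn hd (D := D - LieDerivation.ad ℝ (Der1 n d) x)
    (by rwa [LieDerivation.sub_apply, LieDerivation.ad_apply_apply])).1
  obtain ⟨T, hT⟩ := exists_apply_glAct_eq hn hd h1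
  obtain ⟨c, hc⟩ := exists_smul_ad_gen hn hd
    (D := D - LieDerivation.ad ℝ (Der1 n d) x - LieDerivation.ad ℝ (Der1 n d) (glAct n d T))
    (fun A => by rw [LieDerivation.sub_apply, hT, LieDerivation.ad_apply_apply, sub_self])
  have key : D - LieDerivation.ad ℝ (Der1 n d) (x + glAct n d T + c • glAct n d 1) =
    D - LieDerivation.ad ℝ (Der1 n d) x - LieDerivation.ad ℝ (Der1 n d) (glAct n d T) -
      c • LieDerivation.ad ℝ (Der1 n d) (glAct n d 1) := by
    rw [map_add, map_add, map_smul]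
    abel
  -- The three terms correct `D E`, the action on `𝔤𝔩` and the scalar on `ad V`. The last does not
  -- disturb `𝔤𝔩`, where `E` is central.
  refine ⟨x + glAct n d T + c • glAct n d 1, ?_, ?_⟩
  · intro A
    rw [key, LieDerivation.sub_apply, LieDerivation.sub_apply, hT, LieDerivation.ad_apply_apply,
      sub_self, LieDerivation.smul_apply, LieDerivation.ad_apply_apply, ← LieHom.map_lie,
      Ring.lie_def, one_mul, mul_one, sub_self, map_zero, smul_zero, sub_zero]
  · intro j
    rw [key, LieDerivation.sub_apply, hc, LieDerivation.smul_apply, LieDerivation.ad_apply_apply,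
      LieDerivation.lie_der_ad_eq_ad_der, glAct_one_homog (gen_mem_homog j), Nat.cast_one,
      one_smul, sub_self]

lemma lie_UL_eq_zero {a w : Der1 n d} (ha : a ∈ UL n d) (hw : w ∈ derDeg n d (d - 1)) :
    ⁅w, a⁆ = 0 := by
  have : UL n d ≤ LinearMap.ker (LieAlgebra.ad ℝ (Der1 n d) w) := by
    refine UL_le fun k hk u hu => ?_
    have := lie_mem_derDeg hw hu
    rwa [derDeg_eq_bot (by omega), Submodule.mem_bot] at this
  exact this ha

namespace IsOuter

variable {D : Der2 n d}

lemma apply_derDeg_zero (h : IsOuter D) {u : Der1 n d} (hu : u ∈ derDeg n d 0) : D u = 0 := by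
  obtain ⟨A, rfl⟩ := range_glAct.ge hu
  exact h.apply_glAct A

lemma apply_adV (h : IsOuter D) {u : Der1 n d} (hu : u ∈ adV n d) : D u = 0 :=
  adV_le (S := LinearMap.ker (D : Der1 n d →ₗ[ℝ] Der1 n d)) h.apply_ad_gen hu

lemma apply_ad (h : IsOuter D) (y : FreeNilp n d) :
    D (LieDerivation.ad ℝ (FreeNilp n d) y) = 0 := by
  obtain ⟨a, rfl⟩ := proj_surjective y
  induction a using FreeLieAlgebra.induction_lie with
  | of i => exact h.apply_ad_gen i
  | zero => simp
  | add a b ha hb => rw [map_add, map_add, map_add, ha, hb, add_zero]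
  | smul c a ha => rw [map_smul, map_smul, map_smul, ha, smul_zero]
  | lie a b ha hb =>
    rw [LieHom.map_lie, LieHom.map_lie, D.apply_lie_eq_add, ha, hb, lie_zero, zero_lie, add_zero]

lemma apply_mem_derDeg (h : IsOuter D) (hn : 2 ≤ n) (hd : 2 ≤ d) {k : ℕ} {u : Der1 n d}
    (hu : u ∈ derDeg n d k) : D u ∈ derDeg n d k :=
  (degree_zero_of_apply_mem hn hd (by rw [h.apply_glAct]; exact zero_mem _)).2 k u hu

/-- Applying `D` to `[u, ad x_j] = ad (u x_j)` leaves `ad ((D u) x_j) = 0`. Here `(D u) x_j` has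
degree `k + 1 < d`, below the centre. -/
lemma apply_derDeg_of_lt (h : IsOuter D) (hn : 2 ≤ n) (hd : 2 ≤ d) {k : ℕ} (hk : k < d - 1)
    {u : Der1 n d} (hu : u ∈ derDeg n d k) : D u = 0 := by
  apply derivation_ext
  intro j
  refine eq_zero_of_ad_eq_zero hn (m := 1 + k) (by omega)
    (h.apply_mem_derDeg hn hd hu 1 _ (gen_mem_homog j)) ?_
  have := D.apply_lie_eq_add u (LieDerivation.ad ℝ (FreeNilp n d) (gen n d j))
  rw [h.apply_ad_gen, lie_zero, zero_add, LieDerivation.lie_der_ad_eq_ad_der, h.apply_ad,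
    LieDerivation.lie_der_ad_eq_ad_der] at this
  exact this.symm

lemma apply_mem_derDeg_top (h : IsOuter D) (hn : 2 ≤ n) (hd : 2 ≤ d) (u : Der1 n d) :
    D u ∈ derDeg n d (d - 1) := by
  induction u using derDeg_induction with
  | h k u hu =>
    rcases lt_trichotomy k (d - 1) with hk | rfl | hk
    · rw [h.apply_derDeg_of_lt hn hd hk hu]
      exact zero_mem _
    · exact h.apply_mem_derDeg hn hd hu
    · rw [derDeg_eq_bot (by omega), Submodule.mem_bot] at hu
      simp [hu]
  | h0 => simp
  | hadd u v hu hv => rw [map_add]; exact add_mem hu hv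

/-- The values of `D` have degree `d - 1`, so they commute with `UL`. -/
lemma apply_commUL (h : IsOuter D) (hn : 2 ≤ n) (hd : 2 ≤ d) {u : Der1 n d}
    (hu : u ∈ commUL n d) : D u = 0 := by
  have : commUL n d ≤ LinearMap.ker (D : Der1 n d →ₗ[ℝ] Der1 n d) := by
    refine Submodule.span_le.2 ?_
    rintro _ ⟨a, ha, b, hb, rfl⟩
    change D ⁅a, b⁆ = 0
    rw [D.apply_lie_eq_add, ← lie_skew a,
      lie_UL_eq_zero ha (h.apply_mem_derDeg_top hn hd b),
      lie_UL_eq_zero hb (h.apply_mem_derDeg_top hn hd a), neg_zero, add_zero]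
  exact this hu

lemma apply_lie_derDeg_zero (h : IsOuter D) {s : Der1 n d} (hs : s ∈ derDeg n d 0)
    (u : Der1 n d) : D ⁅s, u⁆ = ⁅s, D u⁆ := by
  rw [D.apply_lie_eq_add, h.apply_derDeg_zero hs, zero_lie, add_zero]

end IsOuter

/-- If an inner derivation vanishes on `𝔤𝔩` and on `ad V`, then it is zero. -/
lemma eq_zero_of_isOuter_ad (hn : 2 ≤ n) (hd : 2 ≤ d) {x : Der1 n d}
    (h : IsOuter (LieDerivation.ad ℝ (Der1 n d) x)) : x = 0 := by
  have h0 : x ∈ derDeg n d 0 := by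
    rw [mem_derDeg, ← lie_skew, ← LieDerivation.ad_apply_apply ℝ, h.apply_glAct]
    simp
  apply derivation_ext
  intro j
  refine eq_zero_of_ad_eq_zero hn (m := 1) (by omega) (h0 1 _ (gen_mem_homog j)) ?_
  rw [← LieDerivation.lie_der_ad_eq_ad_der, ← LieDerivation.ad_apply_apply ℝ, h.apply_ad_gen]

/-! ### The next levels of the tower -/

end FreeNilp

namespace LieDerivation

variable {M : Type*} [LieRing M] [LieAlgebra ℝ M]

lemma ad_injective_of_injective (h : Function.Injective (ad ℝ M)) :
    Function.Injective (ad ℝ (LieDerivation ℝ M M)) := by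
  rw [injective_iff_map_eq_zero]
  intro D hD
  ext x
  apply h
  rw [← lie_der_ad_eq_ad_der, ← ad_apply_apply ℝ, hD]
  simp

/-- `Δ` restricts to a derivation `D` of `ad M ≅ M`. It is determined by this restriction, because
`[H, ad x] = ad (H x)` recovers each `H`. -/
lemma exists_ad_eq_of_forall_exists (h : Function.Injective (ad ℝ M))
    (Δ : LieDerivation ℝ (LieDerivation ℝ M M) (LieDerivation ℝ M M))
    (hΔ : ∀ x, ∃ y, Δ (ad ℝ M x) = ad ℝ M y) : ∃ D, ad ℝ (LieDerivation ℝ M M) D = Δ := by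
  choose f hf using hΔ
  let D : LieDerivation ℝ M M :=
    { toFun := f
      map_add' := fun x y => h (by rw [← hf, map_add, map_add, map_add, hf, hf])
      map_smul' := fun c x => h (by
        rw [← hf, map_smul, map_smul, hf, RingHom.id_apply, map_smul])
      leibniz' := fun x y => h (by
        change ad ℝ M (f _) = ad ℝ M (⁅x, f y⁆ - ⁅y, f x⁆)
        rw [← hf, LieHom.map_lie, Δ.apply_lie_eq_sub, hf, hf, map_sub, LieHom.map_lie,
          LieHom.map_lie]) }
  have hD (x) : ad ℝ M (D x) = Δ (ad ℝ M x) := (hf x).symm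
  refine ⟨D, ?_⟩
  ext H x
  apply h
  have := Δ.apply_lie_eq_add H (ad ℝ M x)
  rw [lie_der_ad_eq_ad_der, ← hD, ← hD, lie_der_ad_eq_ad_der, lie_der_ad_eq_ad_der] at this
  rw [ad_apply_apply, commutator_apply, map_sub, this, add_sub_cancel_left]

lemma ad_bijective_of_bijective (h : Function.Bijective (ad ℝ M)) :
    Function.Bijective (ad ℝ (LieDerivation ℝ M M)) :=
  ⟨ad_injective_of_injective h.1, fun Δ => exists_ad_eq_of_forall_exists h.1 Δ fun x =>
    (h.2 (Δ (ad ℝ M x))).imp fun _ => Eq.symm⟩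

end LieDerivation

lemma StabilizesAtLevel.of_le {L : Type} [LieRing L] [LieAlgebra ℝ L] {j k : ℕ} (hjk : j ≤ k)
    (h : StabilizesAtLevel L j) : StabilizesAtLevel L k := by
  induction k, hjk using Nat.le_induction with
  | base => exact h
  | succ k _ ih => exact LieDerivation.ad_bijective_of_bijective ih

namespace FreeNilp

variable {n d : ℕ}

/-- Inner derivations form an ideal, and each term of `Δ [ad a, ad b]` is a bracket with an inner
derivation. -/
lemma exists_apply_lie_eq_ad (Δ : LieDerivation ℝ (Der2 n d) (Der2 n d)) (a b : Der1 n d) :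
    ∃ y, Δ (LieDerivation.ad ℝ (Der1 n d) ⁅a, b⁆) = LieDerivation.ad ℝ (Der1 n d) y := by
  refine ⟨Δ (LieDerivation.ad ℝ _ a) b - Δ (LieDerivation.ad ℝ _ b) a, ?_⟩
  rw [LieHom.map_lie, Δ.apply_lie_eq_sub, ← lie_skew, LieDerivation.lie_der_ad_eq_ad_der,
    ← lie_skew (LieDerivation.ad ℝ _ b), LieDerivation.lie_der_ad_eq_ad_der, map_sub]
  abel

/-- A derivation of `D² L` maps `ad (D¹ L)` to itself as soon as this holds for `ad E`. -/
lemma exists_apply_ad_eq_ad (hn : 2 ≤ n) (Δ : LieDerivation ℝ (Der2 n d) (Der2 n d))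
    (h : ∃ y, Δ (LieDerivation.ad ℝ (Der1 n d) (glAct n d 1)) = LieDerivation.ad ℝ (Der1 n d) y)
    (x : Der1 n d) : ∃ y, Δ (LieDerivation.ad ℝ (Der1 n d) x) = LieDerivation.ad ℝ (Der1 n d) y := by
  let S : Submodule ℝ (Der1 n d) :=
    { carrier := {x | ∃ y, Δ (LieDerivation.ad ℝ (Der1 n d) x) = LieDerivation.ad ℝ (Der1 n d) y}
      zero_mem' := ⟨0, by simp⟩
      add_mem' := by
        rintro a b ⟨y, hy⟩ ⟨z, hz⟩
        exact ⟨y + z, by rw [map_add, map_add, hy, hz, map_add]⟩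
      smul_mem' := by
        rintro c a ⟨y, hy⟩
        exact ⟨c • y, by rw [map_smul, map_smul, hy, map_smul]⟩ }
  -- Brackets together with `E` span `D¹ L`: positive degrees are brackets with `E`, and `𝔤𝔩` is
  -- spanned by commutators and the identity.
  have hlie (a b : Der1 n d) : ⁅a, b⁆ ∈ S := exists_apply_lie_eq_ad Δ a b
  change x ∈ S
  induction x using derDeg_induction with
  | h k u hu =>
    rcases k with - | k
    · obtain ⟨A, rfl⟩ := range_glAct.ge hu
      have : Nonempty (Fin n) := ⟨⟨0, by omega⟩⟩
      have hS : S.comap (glAct n d : Matrix (Fin n) (Fin n) ℝ →ₗ[ℝ] Der1 n d) = ⊤ :=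
        Matrix.eq_top_of_lie_mem (fun A B => by
          change glAct n d ⁅A, B⁆ ∈ S
          rw [LieHom.map_lie]
          exact hlie _ _) h
      exact hS.ge (Submodule.mem_top (x := A))
    · have := S.smul_mem ((k + 1 : ℕ) : ℝ)⁻¹ (hlie (glAct n d 1) u)
      rwa [mem_derDeg.1 hu, smul_smul, inv_mul_cancel₀ (by positivity), one_smul] at this
  | h0 => exact zero_mem S
  | hadd u v hu hv => exact add_mem hu hv

/-- Every derivation of `D² L` is inner. -/
lemma ad_der2_bijective (hn : 2 ≤ n) (hd : 2 ≤ d) :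
    Function.Bijective (LieDerivation.ad ℝ (Der2 n d)) := by
  have inj := ad_injective hn hd
  refine ⟨LieDerivation.ad_injective_of_injective inj, fun Δ => ?_⟩
  obtain ⟨x, hx⟩ := exists_isOuter_sub_ad hn hd (Δ (LieDerivation.ad ℝ _ (glAct n d 1)))
  obtain ⟨w, hw⟩ := exists_sub_lie_mem x
  set h := Δ (LieDerivation.ad ℝ _ (glAct n d 1)) - LieDerivation.ad ℝ _ x with hdef
  set x₀ := x - ⁅w, glAct n d 1⁆ with hx₀
  let Δ' := Δ - LieDerivation.ad ℝ (Der2 n d) (LieDerivation.ad ℝ (Der1 n d) w)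
  have hE : Δ' (LieDerivation.ad ℝ _ (glAct n d 1)) = LieDerivation.ad ℝ _ x₀ + h := by
    rw [LieDerivation.sub_apply, LieDerivation.ad_apply_apply, ← LieHom.map_lie, hdef, hx₀,
      map_sub]
    abel
  -- With `Δ' (ad a) = ad y`, the relation `[E, a] = k a` yields `k y = [E, y] + [x₀, a] + h a`. The
  -- last two terms have degree `k`, hence so does `y`, and they cancel.
  have key : ∀ k, 1 ≤ k → ∀ a ∈ derDeg n d k, ⁅x₀, a⁆ + h a = 0 := by
    intro k hk a ha
    obtain ⟨y, hy⟩ := exists_apply_lie_eq_ad Δ' (glAct n d 1) a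
    obtain ⟨y, rfl⟩ : ∃ z, y = (k : ℝ) • z :=
      ⟨(k : ℝ)⁻¹ • y, by rw [smul_smul, mul_inv_cancel₀ (by positivity), one_smul]⟩
    rw [mem_derDeg.1 ha, map_smul, map_smul, map_smul,
      (smul_right_injective _ (by positivity : (k : ℝ) ≠ 0)).eq_iff] at hy
    have h1 := Δ'.apply_lie_eq_add (LieDerivation.ad ℝ _ (glAct n d 1)) (LieDerivation.ad ℝ _ a)
    rw [hE, hy, ← LieHom.map_lie, ← LieHom.map_lie, mem_derDeg.1 ha, map_smul, map_smul, hy,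
      add_lie, ← LieHom.map_lie, LieDerivation.lie_der_ad_eq_ad_der, ← map_add, ← map_add,
      ← map_smul] at h1
    have h3 := inj h1
    have h4 : ⁅x₀, a⁆ + h a ∈ derDeg n d k :=
      add_mem (by simpa using lie_mem_derDeg hw ha) (hx.apply_mem_derDeg hn hd ha)
    have h5 : y ∈ derDeg n d k := by
      apply mem_derDeg_of_lie_sub
      rw [h3, sub_add_cancel_left]
      exact neg_mem h4
    rwa [mem_derDeg.1 h5, left_eq_add] at h3
  -- On `a = ad x_j` the outer part `h` vanishes, leaving `ad (x₀ x_j) = 0`.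
  have hx0 : x₀ = 0 := by
    apply derivation_ext
    intro j
    refine eq_zero_of_ad_eq_zero hn (m := 1) (by omega) (hw 1 _ (gen_mem_homog j)) ?_
    have := key 1 le_rfl _ (ad_mem_derDeg (gen_mem_homog j))
    rwa [hx.apply_ad_gen, add_zero, LieDerivation.lie_der_ad_eq_ad_der] at this
  have hh : h = 0 := by
    ext1 u
    induction u using derDeg_induction with
    | h k u hu =>
      rcases k with - | k
      · exact hx.apply_derDeg_zero hu
      · have := key (k + 1) (by omega) u hu
        rwa [hx0, zero_lie, zero_add] at this
    | h0 => simp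
    | hadd u v hu hv => rw [map_add, map_add, hu, hv]
  obtain ⟨D, hD⟩ := LieDerivation.exists_ad_eq_of_forall_exists inj Δ'
    (exists_apply_ad_eq_ad hn Δ' ⟨0, by rw [hE, hx0, hh, add_zero]⟩)
  exact ⟨D + LieDerivation.ad ℝ (Der1 n d) w, by rw [map_add, hD, sub_add_cancel]⟩

/-! ### The case `n = d = 2` -/

lemma derDeg_one_le_adV_of_two : derDeg 2 2 1 ≤ adV 2 2 := by
  intro u hu
  have h (z) (hz : z ∈ homog 2 2 2) : ∃ c : ℝ, z = c • ⁅gen 2 2 0, gen 2 2 1⁆ := by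
    induction hz using homog_two_induction with
    | lie a b =>
      fin_cases a <;> fin_cases b
      · exact ⟨0, by simp⟩
      · exact ⟨1, by simp⟩
      · exact ⟨-1, by simp⟩
      · exact ⟨0, by simp⟩
    | zero => exact ⟨0, by simp⟩
    | add u v _ _ hu hv =>
      obtain ⟨c, rfl⟩ := hu
      obtain ⟨c', rfl⟩ := hv
      exact ⟨c + c', (add_smul _ _ _).symm⟩
    | smul a u _ hu =>
      obtain ⟨c, rfl⟩ := hu
      exact ⟨a * c, smul_smul _ _ _⟩
  obtain ⟨a, ha⟩ := h _ (hu 1 _ (gen_mem_homog 0))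
  obtain ⟨b, hb⟩ := h _ (hu 1 _ (gen_mem_homog 1))
  -- `L^{(2)}` is a line, so `u` amounts to two numbers: `u x_0 = a [x_0, x_1]` and `u x_1 = b [x_0,
  -- x_1]`.
  refine ⟨b • gen 2 2 0 - a • gen 2 2 1, sub_mem (Submodule.smul_mem _ _ (gen_mem_homog 0))
    (Submodule.smul_mem _ _ (gen_mem_homog 1)),
    derivation_ext (Fin.forall_fin_two.2 ⟨?_, ?_⟩)⟩
  · change LieDerivation.ad ℝ (FreeNilp 2 2) _ _ = _
    rw [LieDerivation.ad_apply_apply, sub_lie, smul_lie, smul_lie, lie_self, smul_zero, zero_sub,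
      ← lie_skew, smul_neg, neg_neg, ha]
  · change LieDerivation.ad ℝ (FreeNilp 2 2) _ _ = _
    rw [LieDerivation.ad_apply_apply, sub_lie, smul_lie, smul_lie, lie_self, smul_zero, sub_zero,
      hb]

lemma ad_der1_bijective_of_two : Function.Bijective (LieDerivation.ad ℝ (Der1 2 2)) := by
  refine ⟨ad_injective le_rfl le_rfl, fun D => ?_⟩
  obtain ⟨x, hx⟩ := exists_isOuter_sub_ad le_rfl le_rfl D
  refine ⟨x, ?_⟩
  rw [← sub_eq_zero, ← neg_eq_zero, neg_sub]
  ext1 u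
  induction u using derDeg_induction with
  | h k u hu =>
    rw [LieDerivation.zero_apply]
    rcases k with - | - | k
    · exact hx.apply_derDeg_zero hu
    · exact hx.apply_adV (derDeg_one_le_adV_of_two hu)
    · rw [derDeg_eq_bot (by omega), Submodule.mem_bot] at hu
      rw [hu, map_zero]
  | h0 => simp
  | hadd u v hu hv => rw [map_add, map_add, hu, hv]

end FreeNilp

/-! ### Complete reducibility by means of invariant inner products -/

/-- The family of operators `ρ A` on `M` admits an inner product for which `ρ Aᵀ` is the adjoint
of `ρ A`. -/
def IsUnitarizable {n : ℕ} {M : Type*} [AddCommGroup M] [Module ℝ M]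
    (ρ : Matrix (Fin n) (Fin n) ℝ → M →ₗ[ℝ] M) : Prop :=
  ∃ B : LinearMap.BilinForm ℝ M, (∀ x y, B x y = B y x) ∧ (∀ x, x ≠ 0 → 0 < B x x) ∧
    ∀ A x y, B (ρ A x) y = B x (ρ A.transpose y)

namespace IsUnitarizable

variable {n : ℕ} {M N : Type*} [AddCommGroup M] [Module ℝ M] [AddCommGroup N] [Module ℝ N]
  {ρ : Matrix (Fin n) (Fin n) ℝ → M →ₗ[ℝ] M} {σ : Matrix (Fin n) (Fin n) ℝ → N →ₗ[ℝ] N}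

/-- The orthogonal complement is stable because the adjoint of `ρ A` again belongs to the family. -/
lemma exists_isCompl [FiniteDimensional ℝ M] (h : IsUnitarizable ρ) {S : Submodule ℝ M}
    (hS : ∀ A, ∀ x ∈ S, ρ A x ∈ S) : ∃ S' : Submodule ℝ M, IsCompl S S' ∧
      ∀ A, ∀ x ∈ S', ρ A x ∈ S' := by
  obtain ⟨B, hsymm, hpos, hadj⟩ := h
  have hrefl : B.IsRefl := fun x y hxy => by rw [hsymm, hxy]
  refine ⟨B.orthogonal S, ?_, ?_⟩
  · rw [LinearMap.BilinForm.isCompl_orthogonal_iff_disjoint hrefl, Submodule.disjoint_def]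
    intro x hx hx'
    by_contra hne
    exact (hpos x hne).ne' (hx' x hx)
  · intro A x hx y hy
    have : B (ρ A.transpose y) x = 0 := hx _ (hS A.transpose y hy)
    rw [hadj, Matrix.transpose_transpose] at this
    exact this

/-- A quotient is isomorphic to a stable complement of the kernel and inherits its inner product. -/
lemma of_surjective [FiniteDimensional ℝ M] (h : IsUnitarizable ρ) (f : M →ₗ[ℝ] N)
    (hf : Function.Surjective f) (hρ : ∀ A x, f (ρ A x) = σ A (f x)) : IsUnitarizable σ := by
  obtain ⟨K, hK, hstab⟩ := h.exists_isCompl (S := LinearMap.ker f)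
    (fun A x hx => by rw [LinearMap.mem_ker] at *; rw [hρ, hx, map_zero])
  have hinj : ∀ x ∈ K, ∀ y ∈ K, f x = f y → x = y := by
    intro x hx y hy hxy
    have := hK.disjoint.le_bot (x := x - y) ⟨by simp [hxy], sub_mem hx hy⟩
    exact sub_eq_zero.1 this
  let e : K ≃ₗ[ℝ] N := LinearEquiv.ofBijective (f.domRestrict K)
    ⟨fun x y hxy => Subtype.ext (hinj x x.2 y y.2 hxy), fun z => by
      obtain ⟨x, rfl⟩ := hf z
      obtain ⟨u, hu, v, hv, rfl⟩ := Submodule.mem_sup.1 (hK.sup_eq_top.ge (Submodule.mem_top (x := x)))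
      exact ⟨⟨v, hv⟩, by simp [LinearMap.mem_ker.1 hu]⟩⟩
  let s : N →ₗ[ℝ] M := K.subtype ∘ₗ e.symm.toLinearMap
  have hs (x) : f (s x) = x := e.apply_symm_apply x
  have hsK (x) : s x ∈ K := (e.symm x).2
  have hcomm (A x) : s (σ A x) = ρ A (s x) :=
    hinj _ (hsK _) _ (hstab A _ (hsK _)) (by rw [hs, hρ, hs])
  obtain ⟨B, hsymm, hpos, hadj⟩ := h
  refine ⟨B.comp s s, fun x y => hsymm _ _, fun x hx => hpos _ fun h0 => hx ?_, fun A x y => ?_⟩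
  · rw [← hs x, h0, map_zero]
  · simp only [LinearMap.BilinForm.comp_apply, hcomm, hadj]

/-- Twisting the sum of `n` copies of a unitarizable module by matrices. -/
lemma pi (h : IsUnitarizable ρ) (τ : Matrix (Fin n) (Fin n) ℝ → Matrix (Fin n) (Fin n) ℝ)
    (hτ : ∀ A, τ A.transpose = (τ A).transpose)
    {ρ' : Matrix (Fin n) (Fin n) ℝ → (Fin n → M) →ₗ[ℝ] (Fin n → M)}
    (hρ' : ∀ A u i, ρ' A u i = ρ A (u i) + ∑ j, τ A i j • u j) : IsUnitarizable ρ' := by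
  obtain ⟨B, hsymm, hpos, hadj⟩ := h
  let C : LinearMap.BilinForm ℝ (Fin n → M) :=
    ∑ i, B.comp (LinearMap.proj i) (LinearMap.proj i)
  have hC (u v) : C u v = ∑ i, B (u i) (v i) := by
    simp [C]
  have hnn (x) : 0 ≤ B x x := by
    rcases eq_or_ne x 0 with rfl | hx
    · simp
    · exact (hpos x hx).le
  refine ⟨C, fun u v => ?_, fun u hu => ?_, fun A u v => ?_⟩
  · rw [hC, hC]
    exact Finset.sum_congr rfl fun i _ => hsymm _ _
  · obtain ⟨i, hi⟩ := Function.ne_iff.1 hu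
    rw [hC]
    exact Finset.sum_pos' (fun i _ => hnn _) ⟨i, Finset.mem_univ i, hpos _ hi⟩
  · simp only [hC, hρ', map_add, map_sum, map_smul, LinearMap.add_apply, LinearMap.sum_apply,
      LinearMap.smul_apply, Finset.sum_add_distrib, hadj, hτ, Matrix.transpose_apply]
    congr 1
    exact Finset.sum_comm

lemma prod_real (h : IsUnitarizable ρ) : IsUnitarizable fun A =>
    (LinearMap.prodMap 0 (ρ A) : ℝ × M →ₗ[ℝ] ℝ × M) := by
  obtain ⟨B, hsymm, hpos, hadj⟩ := h
  let C : LinearMap.BilinForm ℝ (ℝ × M) :=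
    (LinearMap.mul ℝ ℝ).compl₁₂ (LinearMap.fst ℝ ℝ M) (LinearMap.fst ℝ ℝ M) +
      B.compl₁₂ (LinearMap.snd ℝ ℝ M) (LinearMap.snd ℝ ℝ M)
  have hC (u v) : C u v = u.1 * v.1 + B u.2 v.2 := rfl
  refine ⟨C, fun u v => ?_, fun u hu => ?_, fun A u v => ?_⟩
  · rw [hC, hC, hsymm, mul_comm]
  · rw [hC]
    rcases eq_or_ne u.2 0 with h2 | h2
    · have h1 : u.1 ≠ 0 := fun h1 => hu (Prod.ext h1 h2)
      rw [h2, map_zero, add_zero]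
      exact mul_self_pos.2 h1
    · exact add_pos_of_nonneg_of_pos (mul_self_nonneg _) (hpos _ h2)
  · rw [hC, hC]
    simp [hadj]

end IsUnitarizable

/-! ### Invariant inner products on `L` and `D¹ L` -/

namespace FreeNilp

variable {n d : ℕ}

/-- The operators by which `𝔤𝔩` acts on `V ⊗ (ℝ ⊕ M)`, where `ρ` is the action on `M`. -/
def tensorAct {M : Type*} [AddCommGroup M] [Module ℝ M]
    (ρ : Matrix (Fin n) (Fin n) ℝ → M →ₗ[ℝ] M) (A : Matrix (Fin n) (Fin n) ℝ) :
    (Fin n → ℝ × M) →ₗ[ℝ] (Fin n → ℝ × M) :=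
  LinearMap.pi fun i => LinearMap.prodMap 0 (ρ A) ∘ₗ LinearMap.proj i +
    ∑ j, A i j • LinearMap.proj j

/-- `V ⊗ (ℝ ⊕ M)` maps to `L` by `x_i ⊗ (c, m) ↦ c x_i + [x_i, f m]`. Iteration reaches all
right-normed brackets from modules with an evident inner product. -/
lemma exists_unitarizable_cover (k : ℕ) : ∃ (M : Type) (_ : AddCommGroup M) (_ : Module ℝ M)
    (_ : FiniteDimensional ℝ M) (ρ : Matrix (Fin n) (Fin n) ℝ → M →ₗ[ℝ] M)
    (f : M →ₗ[ℝ] FreeNilp n d), IsUnitarizable ρ ∧ (∀ A x, f (ρ A x) = glAct n d A (f x)) ∧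
      ∀ j ≤ k, homog n d j ≤ LinearMap.range f := by
  induction k with
  | zero =>
    refine ⟨PUnit, inferInstance, inferInstance, inferInstance, fun _ => 0, 0,
      ⟨0, by simp, fun x hx => absurd (Subsingleton.elim x 0) hx, by simp⟩, by simp, ?_⟩
    intro j hj
    obtain rfl : j = 0 := by omega
    simp [homog_zero]
  | succ k ih =>
    obtain ⟨M, _, _, _, ρ, f, hρ, hf, hk⟩ := ih
    let g (i : Fin n) : ℝ × M →ₗ[ℝ] FreeNilp n d :=
      (LinearMap.toSpanSingleton ℝ _ (gen n d i)).coprod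
        (LieAlgebra.ad ℝ (FreeNilp n d) (gen n d i) ∘ₗ f)
    have hg (i c m) : g i (c, m) = c • gen n d i + ⁅gen n d i, f m⁆ := rfl
    let F : (Fin n → ℝ × M) →ₗ[ℝ] FreeNilp n d := ∑ i, g i ∘ₗ LinearMap.proj i
    have hF (u) : F u = ∑ i, ((u i).1 • gen n d i + ⁅gen n d i, f (u i).2⁆) := by
      simp [F, g]
    refine ⟨Fin n → ℝ × M, inferInstance, inferInstance, inferInstance, tensorAct ρ, F,
      hρ.prod_real.pi id (fun _ => rfl) fun A u i => ?_, fun A u => ?_, ?_⟩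
    · simp [tensorAct]
    · have h1 (i) : glAct n d A ((u i).1 • gen n d i + ⁅gen n d i, f (u i).2⁆) =
          ⁅gen n d i, f (ρ A (u i).2)⁆ +
            ∑ k, A k i • ((u i).1 • gen n d k + ⁅gen n d k, f (u i).2⁆) := by
        rw [map_add, map_smul, LieDerivation.apply_lie_eq_add, glAct_gen, hf, sum_lie]
        simp only [smul_lie, smul_add, Finset.sum_add_distrib, Finset.smul_sum, smul_comm (u i).1]
        abel
      have h2 (i) : (tensorAct ρ A u i).1 • gen n d i + ⁅gen n d i, f (tensorAct ρ A u i).2⁆ =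
          ⁅gen n d i, f (ρ A (u i).2)⁆ +
            ∑ k, A i k • ((u k).1 • gen n d i + ⁅gen n d i, f (u k).2⁆) := by
        simp only [tensorAct, LinearMap.pi_apply, LinearMap.add_apply, LinearMap.comp_apply,
          LinearMap.proj_apply, LinearMap.prodMap_apply, LinearMap.sum_apply,
          LinearMap.smul_apply, Prod.fst_add, Prod.snd_add, Prod.fst_sum, Prod.snd_sum,
          Prod.smul_fst, Prod.smul_snd, LinearMap.zero_apply, zero_add, map_add, map_sum, map_smul,
          lie_add, lie_sum, lie_smul, Finset.sum_smul, smul_assoc, smul_add,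
          Finset.sum_add_distrib]
        abel
      rw [hF, hF, map_sum]
      simp_rw [h1, h2, Finset.sum_add_distrib]
      congr 1
      exact Finset.sum_comm
    · have hmem (i p) : g i p ∈ LinearMap.range F := by
        refine ⟨Pi.single i p, ?_⟩
        rw [hF, Finset.sum_eq_single i]
        · simp [g]
        · intro j _ hj
          simp [hj]
        · simp
      intro j hj
      rcases j with - | - | j
      · simp [homog_zero]
      · rw [homog_succ]
        refine Submodule.span_le.2 ?_
        rintro _ ⟨i, rfl⟩
        simpa [hg] using hmem i (1, 0)
      · rw [homog_succ]
        refine Submodule.span_le.2 ?_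
        rintro _ ⟨i, y, hy, rfl⟩
        rw [← homog_succ] at hy
        obtain ⟨m, rfl⟩ := hk (j + 1) (by omega) hy
        simpa [hg] using hmem i (0, m)

lemma exists_unitarizable_surjection : ∃ (M : Type) (_ : AddCommGroup M) (_ : Module ℝ M)
    (_ : FiniteDimensional ℝ M) (ρ : Matrix (Fin n) (Fin n) ℝ → M →ₗ[ℝ] M)
    (f : M →ₗ[ℝ] FreeNilp n d), IsUnitarizable ρ ∧ (∀ A x, f (ρ A x) = glAct n d A (f x)) ∧
      Function.Surjective f := by
  obtain ⟨M, _, _, _, ρ, f, hρ, hf, hk⟩ := exists_unitarizable_cover (n := n) (d := d) d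
  refine ⟨M, _, _, ‹_›, ρ, f, hρ, hf, ?_⟩
  rw [← LinearMap.range_eq_top, eq_top_iff, ← iSup_homog]
  refine iSup_le fun j => ?_
  by_cases hj : j ≤ d
  · exact hk j hj
  · simp [homog_eq_bot (not_le.1 hj)]

instance : FiniteDimensional ℝ (FreeNilp n d) := by
  obtain ⟨M, _, _, _, -, f, -, -, hf⟩ := exists_unitarizable_surjection (n := n) (d := d)
  exact Module.Finite.of_surjective f hf

instance : FiniteDimensional ℝ (Der1 n d) := Module.Finite.equiv (evalGen n d).symm

/-- Evaluation on generators identifies `D¹ L` with `V* ⊗ L`, where `A` acts on `V*` by `-Aᵀ`. -/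
lemma isUnitarizable_der1 : IsUnitarizable fun A : Matrix (Fin n) (Fin n) ℝ =>
    LieAlgebra.ad ℝ (Der1 n d) (glAct n d A) := by
  obtain ⟨M, _, _, _, ρ, f, hρ, hf, hsurj⟩ := exists_unitarizable_surjection (n := n) (d := d)
  have hL : IsUnitarizable fun A => (glAct n d A : FreeNilp n d →ₗ[ℝ] FreeNilp n d) :=
    hρ.of_surjective f hsurj hf
  let ρ' (A : Matrix (Fin n) (Fin n) ℝ) : (Fin n → FreeNilp n d) →ₗ[ℝ] (Fin n → FreeNilp n d) :=
    LinearMap.pi fun i => (glAct n d A : FreeNilp n d →ₗ[ℝ] FreeNilp n d) ∘ₗ LinearMap.proj i +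
      ∑ j, (-A.transpose) i j • LinearMap.proj j
  have hρ' : IsUnitarizable ρ' :=
    hL.pi (fun A => -A.transpose) (fun A => by simp) (fun A u i => by simp [ρ'])
  refine hρ'.of_surjective (evalGen n d).symm.toLinearMap (evalGen n d).symm.surjective
    fun A u => derivation_ext fun j => ?_
  rw [LieAlgebra.ad_apply, LieDerivation.commutator_apply]
  simp [ρ', ← sub_eq_add_neg]

/-! ### Existence of the generating modules -/

lemma slDer_subset : slDer n d ⊆ derDeg n d 0 := by
  rintro s ⟨A, -, hA⟩
  exact range_glAct.le ⟨A, derivation_ext fun j => by rw [hA]; exact glAct_gen A j⟩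

lemma lie_UL_mem {s a : Der1 n d} (hs : s ∈ derDeg n d 0) (ha : a ∈ UL n d) : ⁅s, a⁆ ∈ UL n d := by
  have : UL n d ≤ (UL n d).comap (LieAlgebra.ad ℝ (Der1 n d) s) := by
    refine UL_le fun k hk u hu => derDeg_le_UL hk ?_
    simpa using lie_mem_derDeg hs hu
  exact this ha

lemma lie_commUL_mem {s a : Der1 n d} (hs : s ∈ derDeg n d 0) (ha : a ∈ commUL n d) :
    ⁅s, a⁆ ∈ commUL n d := by
  have : commUL n d ≤ (commUL n d).comap (LieAlgebra.ad ℝ (Der1 n d) s) := by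
    refine Submodule.span_le.2 ?_
    rintro _ ⟨a, ha, b, hb, rfl⟩
    change ⁅s, ⁅a, b⁆⁆ ∈ commUL n d
    rw [leibniz_lie]
    exact add_mem (Submodule.subset_span ⟨_, lie_UL_mem hs ha, _, hb, rfl⟩)
      (Submodule.subset_span ⟨_, ha, _, lie_UL_mem hs hb, rfl⟩)
  exact this ha

lemma lie_adV_mem {s a : Der1 n d} (hs : s ∈ derDeg n d 0) (ha : a ∈ adV n d) :
    ⁅s, a⁆ ∈ adV n d := by
  obtain ⟨y, hy, rfl⟩ := ha
  exact ⟨s y, hs 1 y hy, (LieDerivation.lie_der_ad_eq_ad_der s y).symm⟩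

lemma commUL_le_UL : commUL n d ≤ UL n d := by
  refine Submodule.span_le.2 ?_
  rintro _ ⟨a, ha, b, hb, rfl⟩
  rw [SetLike.mem_coe, ← neg_mem_iff, lie_skew]
  have : UL n d ≤ (UL n d).comap (LieAlgebra.ad ℝ (Der1 n d) b) := by
    refine UL_le fun k hk u hu => ?_
    change ⁅b, u⁆ ∈ UL n d
    rw [← neg_mem_iff, lie_skew]
    have : UL n d ≤ (UL n d).comap (LieAlgebra.ad ℝ (Der1 n d) u) := by
      exact UL_le fun l _ v hv => derDeg_le_UL (by omega) (lie_mem_derDeg hu hv)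
    exact this hb
  exact this ha

lemma adV_le_UL : adV n d ≤ UL n d := adV_le_derDeg.trans (derDeg_le_UL le_rfl)

/-- Commutators of elements of `UL` have degrees at least 2, while `ad V` has degree 1. -/
lemma disjoint_commUL_adV : Disjoint (commUL n d) (adV n d) := by
  refine Disjoint.symm ((iSupIndep_derDeg (n := n) (d := d) 1).mono adV_le_derDeg ?_)
  set N := ⨆ j, ⨆ (_ : j ≠ 1), derDeg n d j
  refine Submodule.span_le.2 ?_
  rintro _ ⟨a, ha, b, hb, rfl⟩
  rw [SetLike.mem_coe, ← neg_mem_iff, lie_skew]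
  have : UL n d ≤ N.comap (LieAlgebra.ad ℝ (Der1 n d) b) := by
    refine UL_le fun k hk u hu => ?_
    change ⁅b, u⁆ ∈ N
    rw [← neg_mem_iff, lie_skew]
    have : UL n d ≤ N.comap (LieAlgebra.ad ℝ (Der1 n d) u) := by
      refine UL_le fun l hl v hv => ?_
      exact Submodule.mem_iSup_of_mem (k + l)
        (Submodule.mem_iSup_of_mem (by omega) (lie_mem_derDeg hu hv))
    exact this hb
  exact this ha

lemma eq_iSup_inf_derDeg {S : Submodule ℝ (Der1 n d)}
    (hS : ∀ u ∈ S, ⁅glAct n d 1, u⁆ ∈ S) : S = ⨆ k, S ⊓ derDeg n d k :=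
  DiagEnd.eq_iSup_inf (T := LieAlgebra.ad ℝ (Der1 n d) (glAct n d 1))
    (fun _ _ hy => mem_derDeg.1 hy) iSup_derDeg (fun _ hk => derDeg_eq_bot hk) hS

lemma glAct_mem_derDeg (A : Matrix (Fin n) (Fin n) ℝ) : glAct n d A ∈ derDeg n d 0 :=
  range_glAct.le ⟨A, rfl⟩

lemma isGradedSlSubmodule_of_forall {S : Submodule ℝ (Der1 n d)}
    (h : ∀ s ∈ derDeg n d 0, ∀ u ∈ S, ⁅s, u⁆ ∈ S) : IsGradedSlSubmodule S :=
  ⟨fun s hs u hu => h s (slDer_subset hs) u hu, eq_iSup_inf_derDeg (h _ (glAct_mem_derDeg 1))⟩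

/-- `P` is a stable complement of `[UL,UL] + ad V`, cut down to `UL` by the modular law; then `U =
ad V + P`. -/
lemma exists_isUgen_isUgenPlus : ∃ U P : Submodule ℝ (Der1 n d), IsUgen U ∧ IsUgenPlus U P := by
  have hS : ∀ s ∈ derDeg n d 0, ∀ u ∈ commUL n d ⊔ adV n d, ⁅s, u⁆ ∈ commUL n d ⊔ adV n d := by
    intro s hs u hu
    obtain ⟨a, ha, b, hb, rfl⟩ := Submodule.mem_sup.1 hu
    rw [lie_add]
    exact Submodule.add_mem_sup (lie_commUL_mem hs ha) (lie_adV_mem hs hb)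
  obtain ⟨S', hc, hS'⟩ := isUnitarizable_der1.exists_isCompl
    (fun A u hu => hS _ (glAct_mem_derDeg A) u hu)
  have hP : ∀ s ∈ derDeg n d 0, ∀ u ∈ S' ⊓ UL n d, ⁅s, u⁆ ∈ S' ⊓ UL n d := by
    rintro s hs u ⟨hu, hu'⟩
    obtain ⟨A, rfl⟩ := range_glAct.ge hs
    exact ⟨hS' A u hu, lie_UL_mem hs hu'⟩
  have hle : commUL n d ⊔ adV n d ≤ UL n d := sup_le commUL_le_UL adV_le_UL
  have hd : Disjoint (commUL n d ⊔ adV n d) (S' ⊓ UL n d) := hc.disjoint.mono_right inf_le_left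
  refine ⟨adV n d ⊔ S' ⊓ UL n d, S' ⊓ UL n d,
    ⟨isGradedSlSubmodule_of_forall fun s hs u hu => ?_, ?_, ?_⟩,
    ⟨isGradedSlSubmodule_of_forall hP, ?_, rfl⟩⟩
  · obtain ⟨a, ha, b, hb, rfl⟩ := Submodule.mem_sup.1 hu
    rw [lie_add]
    exact Submodule.add_mem_sup (lie_adV_mem hs ha) (hP s hs b hb)
  · exact disjoint_commUL_adV.disjoint_sup_right_of_disjoint_sup_left hd
  · rw [← sup_assoc, ← sup_inf_assoc_of_le _ hle, hc.sup_eq_top, top_inf_eq]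
  · exact hd.mono_left le_sup_right

/-! ### Outer derivations from equivariant maps in degree `d - 1` -/

/-- The subspace of `D¹ L` on which the derivations in `Hom_𝔰𝔩(U_gen⁺ ∩ UL^{(d-1)}, UL^{(d-1)})`
vanish. -/
def outerKer (n d : ℕ) : Submodule ℝ (Der1 n d) :=
  (⨆ k, ⨆ (_ : k < d - 1), derDeg n d k) ⊔ (commUL n d ⊔ adV n d)

lemma derDeg_le_outerKer {k : ℕ} (hk : k < d - 1) : derDeg n d k ≤ outerKer n d :=
  (le_iSup₂_of_le (f := fun k (_ : k < d - 1) => derDeg n d k) k hk le_rfl).trans le_sup_left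

lemma commUL_le_outerKer : commUL n d ≤ outerKer n d := le_sup_left.trans le_sup_right

lemma adV_le_outerKer : adV n d ≤ outerKer n d := le_sup_right.trans le_sup_right

lemma outerKer_le {S : Submodule ℝ (Der1 n d)} (h : ∀ k < d - 1, derDeg n d k ≤ S)
    (h1 : commUL n d ≤ S) (h2 : adV n d ≤ S) : outerKer n d ≤ S :=
  sup_le (iSup₂_le h) (sup_le h1 h2)

lemma lie_outerKer_mem {s u : Der1 n d} (hs : s ∈ derDeg n d 0) (hu : u ∈ outerKer n d) :
    ⁅s, u⁆ ∈ outerKer n d := by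
  have : outerKer n d ≤ (outerKer n d).comap (LieAlgebra.ad ℝ (Der1 n d) s) :=
    outerKer_le
      (fun k hk u hu => derDeg_le_outerKer hk (by simpa using lie_mem_derDeg hs hu))
      (fun u hu => commUL_le_outerKer (lie_commUL_mem hs hu))
      (fun u hu => adV_le_outerKer (lie_adV_mem hs hu))
  exact this hu

/-- For disjointness, the projection to degree `d - 1` fixes `x` and maps `outerKer n d` into
`[UL,UL] + ad V`, which meets `P` trivially. -/
lemma isCompl_outerKer (hd : 2 ≤ d) {U P : Submodule ℝ (Der1 n d)} (hU : IsUgen U)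
    (hP : IsUgenPlus U P) : IsCompl (P ⊓ derDeg n d (d - 1)) (outerKer n d) := by
  constructor
  · rw [Submodule.disjoint_def]
    rintro x ⟨hxP, hxW⟩ hxN
    have hdisj : Disjoint (commUL n d ⊔ adV n d) P :=
      hP.disjoint.disjoint_sup_left_of_disjoint_sup_right (hP.sup_eq ▸ hU.disjoint)
    refine (Submodule.disjoint_def.1 hdisj) x ?_ hxP
    let T : Module.End ℝ (Der1 n d) := LieAlgebra.ad ℝ (Der1 n d) (glAct n d 1)
    have hT {k} {y : Der1 n d} (hy : y ∈ derDeg n d k) : T y = (k : ℝ) • y := mem_derDeg.1 hy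
    have hcomp : DiagEnd.component T d (d - 1) x = x := by
      rw [DiagEnd.component_apply (by omega) (by omega) (hT hxW), if_pos rfl]
    rw [← hcomp]
    have : outerKer n d ≤ (commUL n d ⊔ adV n d).comap (DiagEnd.component T d (d - 1)) := by
      refine outerKer_le (fun k hk u hu => ?_) (fun u hu => ?_) (fun u hu => ?_)
      · rw [Submodule.mem_comap, DiagEnd.component_apply (by omega) (by omega) (hT hu),
          if_neg hk.ne]
        exact zero_mem _
      · exact le_sup_left (a := commUL n d) (DiagEnd.component_mem
          (fun y hy => lie_commUL_mem (glAct_mem_derDeg 1) hy) _ hu)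
      · exact le_sup_right (b := adV n d) (DiagEnd.component_mem
          (fun y hy => lie_adV_mem (glAct_mem_derDeg 1) hy) _ hu)
    exact this hxN
  · set N := P ⊓ derDeg n d (d - 1) ⊔ outerKer n d with hN
    rw [codisjoint_iff, eq_top_iff, ← iSup_derDeg]
    have hlow {k} (hk : k < d - 1) : derDeg n d k ≤ N := (derDeg_le_outerKer hk).trans le_sup_right
    have hPN : P ≤ N := by
      rw [hP.graded]
      refine iSup_le fun k => ?_
      rcases lt_trichotomy k (d - 1) with hk | rfl | hk
      · exact inf_le_right.trans (hlow hk)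
      · exact le_sup_left
      · simp [derDeg_eq_bot (show d ≤ k by omega)]
    refine iSup_le fun k => ?_
    rcases lt_or_ge k (d - 1) with hk | hk
    · exact hlow hk
    · refine (derDeg_le_UL (by omega)).trans ?_
      rw [← hU.sup_eq, ← hP.sup_eq]
      exact sup_le (commUL_le_outerKer.trans le_sup_right)
        (sup_le (adV_le_outerKer.trans le_sup_right) hPN)

section

variable {U P : Submodule ℝ (Der1 n d)}

/-- The extension by zero of a linear map `P ∩ UL^{(d-1)} → UL^{(d-1)}` to `D¹ L`. -/
def extendZero (hc : IsCompl (P ⊓ derDeg n d (d - 1)) (outerKer n d))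
    (φ : ↥(P ⊓ derDeg n d (d - 1)) →ₗ[ℝ] derDeg n d (d - 1)) : Der1 n d →ₗ[ℝ] Der1 n d :=
  (derDeg n d (d - 1)).subtype ∘ₗ φ ∘ₗ Submodule.projectionOnto _ _ hc

variable {hc : IsCompl (P ⊓ derDeg n d (d - 1)) (outerKer n d)}
  {φ : ↥(P ⊓ derDeg n d (d - 1)) →ₗ[ℝ] derDeg n d (d - 1)}

lemma extendZero_mem (u : Der1 n d) : extendZero hc φ u ∈ derDeg n d (d - 1) :=
  (φ (Submodule.projectionOnto _ _ hc u)).2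

lemma extendZero_coe (u : ↥(P ⊓ derDeg n d (d - 1))) : extendZero hc φ u = φ u := by
  change ((φ (Submodule.projectionOnto _ _ hc u) : derDeg n d (d - 1)) : Der1 n d) = _
  rw [Submodule.projectionOnto_apply_left]

lemma extendZero_of_mem {u : Der1 n d} (hu : u ∈ outerKer n d) : extendZero hc φ u = 0 := by
  change ((φ (Submodule.projectionOnto _ _ hc u) : derDeg n d (d - 1)) : Der1 n d) = _
  rw [(Submodule.projectionOnto_apply_eq_zero_iff hc).2 hu, map_zero, Submodule.coe_zero]

lemma extendZero_lie (hP : IsUgenPlus U P)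
    (hφ : φ ∈ homSl (P ⊓ derDeg n d (d - 1)) (derDeg n d (d - 1))) {s : Der1 n d}
    (hs : s ∈ derDeg n d 0) (u : Der1 n d) :
    extendZero hc φ ⁅s, u⁆ = ⁅s, extendZero hc φ u⁆ := by
  have hu : u ∈ P ⊓ derDeg n d (d - 1) ⊔ outerKer n d := hc.sup_eq_top ▸ Submodule.mem_top
  obtain ⟨q, hq, v, hv, rfl⟩ := Submodule.mem_sup.1 hu
  rw [lie_add, map_add, map_add, extendZero_of_mem hv, add_zero,
    extendZero_of_mem (lie_outerKer_mem hs hv), add_zero]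
  obtain ⟨A, rfl⟩ := range_glAct.ge hs
  -- Only `𝔰𝔩`-equivariance is given. It extends to `𝔤𝔩` because `E` acts by the same scalar `d - 1`
  -- on source and target.
  have hsplit : A = (A - (A.trace / n) • 1) + (A.trace / n) • 1 := (sub_add_cancel _ _).symm
  have hsl : glAct n d (A - (A.trace / n) • 1) ∈ slDer n d := by
    rcases n.eq_zero_or_pos with rfl | hn
    · exact ⟨_, by simp [Matrix.trace], glAct_gen _⟩
    · refine ⟨_, ?_, glAct_gen _⟩
      rw [Matrix.trace_sub, Matrix.trace_smul, Matrix.trace_one, Fintype.card_fin, smul_eq_mul,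
        div_mul_cancel₀ _ (by positivity), sub_self]
  change extendZero hc φ ⁅glAct n d A, q⁆ = ⁅glAct n d A, extendZero hc φ q⁆
  rw [hsplit, map_add, map_smul, add_lie, add_lie, smul_lie, smul_lie, mem_derDeg.1 hq.2,
    mem_derDeg.1 (extendZero_mem q), map_add, map_smul, map_smul]
  congr 1
  have hmem : ⁅glAct n d (A - (A.trace / n) • 1), q⁆ ∈ P ⊓ derDeg n d (d - 1) :=
    ⟨hP.lie_mem _ hsl _ hq.1, by simpa using lie_mem_derDeg (slDer_subset hsl) hq.2⟩
  have h1 := extendZero_coe (hc := hc) (φ := φ) ⟨_, hmem⟩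
  have h2 := extendZero_coe (hc := hc) (φ := φ) ⟨q, hq⟩
  have h3 := hφ _ hsl ⟨q, hq⟩ ⟨_, hmem⟩ rfl
  exact h1.trans (h3.trans (congrArg _ h2.symm))

/-- On `𝔤𝔩` against anything this is equivariance. On `UL` against `UL` both sides vanish: the map
kills `[UL,UL]` and its values are central in `UL`. -/
lemma extendZero_leibniz (hd : 2 ≤ d) (hP : IsUgenPlus U P)
    (hφ : φ ∈ homSl (P ⊓ derDeg n d (d - 1)) (derDeg n d (d - 1))) (a b : Der1 n d) :
    extendZero hc φ ⁅a, b⁆ = ⁅a, extendZero hc φ b⁆ - ⁅b, extendZero hc φ a⁆ := by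
  have hsplit (u : Der1 n d) : ∃ s ∈ derDeg n d 0, ∃ v ∈ UL n d, s + v = u :=
    Submodule.mem_sup.1 (isCompl_derDeg_zero.sup_eq_top.ge Submodule.mem_top)
  have hUL {v : Der1 n d} (hv : v ∈ UL n d) (u : Der1 n d) : ⁅v, extendZero hc φ u⁆ = 0 := by
    rw [← lie_skew, lie_UL_eq_zero hv (extendZero_mem u), neg_zero]
  have h0 {s : Der1 n d} (hs : s ∈ derDeg n d 0) : extendZero hc φ s = 0 :=
    extendZero_of_mem (derDeg_le_outerKer (by omega) hs)
  obtain ⟨s, hs, v, hv, rfl⟩ := hsplit a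
  obtain ⟨t, ht, w, hw, rfl⟩ := hsplit b
  have h1 : extendZero hc φ ⁅v, w⁆ = 0 :=
    extendZero_of_mem (commUL_le_outerKer (Submodule.subset_span ⟨v, hv, w, hw, rfl⟩))
  have h2 : extendZero hc φ ⁅v, t⁆ = -⁅t, extendZero hc φ v⁆ := by
    rw [← lie_skew, map_neg, extendZero_lie hP hφ ht]
  rw [add_lie s v (t + w), map_add _ ⁅s, t + w⁆, extendZero_lie hP hφ hs, lie_add v,
    map_add _ ⁅v, t⁆, h1, h2, add_lie, add_lie,
    hUL hv, hUL hw, map_add _ s v, h0 hs, zero_add]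
  abel

/-- The derivations of `D¹ L` given by `Hom_𝔰𝔩(U_gen⁺ ∩ UL^{(d-1)}, UL^{(d-1)})`. -/
def outerDer (hd : 2 ≤ d) (hP : IsUgenPlus U P)
    (hc : IsCompl (P ⊓ derDeg n d (d - 1)) (outerKer n d)) :
    homSl (P ⊓ derDeg n d (d - 1)) (derDeg n d (d - 1)) →ₗ[ℝ] Der2 n d where
  toFun φ := ⟨extendZero hc φ.1, extendZero_leibniz hd hP φ.2⟩
  map_add' φ ψ := by
    ext1 u
    rfl
  map_smul' c φ := by
    ext1 u
    rfl

lemma outerDer_apply (hd : 2 ≤ d) (hP : IsUgenPlus U P)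
    (φ : homSl (P ⊓ derDeg n d (d - 1)) (derDeg n d (d - 1))) (u : Der1 n d) :
    outerDer hd hP hc φ u = extendZero hc φ.1 u := rfl

lemma isOuter_outerDer (hd : 2 ≤ d) (hP : IsUgenPlus U P)
    (φ : homSl (P ⊓ derDeg n d (d - 1)) (derDeg n d (d - 1))) : IsOuter (outerDer hd hP hc φ) :=
  ⟨fun A => extendZero_of_mem (derDeg_le_outerKer (by omega) (glAct_mem_derDeg A)),
    fun j => extendZero_of_mem (adV_le_outerKer (ad_gen_mem_adV j))⟩

/-- An outer derivation kills `outerKer n d` and commutes with `𝔰𝔩`, so it is recovered from its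
restriction to the complement. -/
lemma exists_outerDer_eq (hn : 2 ≤ n) (hd : 2 ≤ d) (hP : IsUgenPlus U P) {D : Der2 n d}
    (hD : IsOuter D) : ∃ φ, outerDer hd hP hc φ = D := by
  refine ⟨⟨((D : Der1 n d →ₗ[ℝ] Der1 n d).codRestrict _
    (hD.apply_mem_derDeg_top hn hd)) ∘ₗ (P ⊓ derDeg n d (d - 1)).subtype, ?_⟩, ?_⟩
  · intro s hs u v huv
    change D v = ⁅s, D u⁆
    rw [huv, hD.apply_lie_derDeg_zero (slDer_subset hs)]
  · ext1 u
    have hu : u ∈ P ⊓ derDeg n d (d - 1) ⊔ outerKer n d := hc.sup_eq_top ▸ Submodule.mem_top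
    obtain ⟨q, hq, v, hv, rfl⟩ := Submodule.mem_sup.1 hu
    have hle : outerKer n d ≤ LinearMap.ker (D : Der1 n d →ₗ[ℝ] Der1 n d) :=
      outerKer_le (fun k hk u hu => hD.apply_derDeg_of_lt hn hd hk hu)
        (fun u hu => hD.apply_commUL hn hd hu) (fun u hu => hD.apply_adV hu)
    have hv0 : D v = 0 := hle hv
    rw [map_add, map_add, hv0, outerDer_apply, outerDer_apply, extendZero_of_mem hv]
    exact congrArg (· + (0 : Der1 n d)) (extendZero_coe (hc := hc) ⟨q, hq⟩)

end

end FreeNilp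

end

/-! ### Assembly of the tower -/

theorem mainTheorem6 (n d : ℕ) (hn : 2 ≤ n) (hd : 2 ≤ d) :
    ((3 ≤ d ∨ 3 ≤ n) →
      -- `D¹ L[V,d] = 𝔤𝔩 + UL[V,d]`, with `𝔤𝔩 = D L^{(0)}` acting naturally on `V`
      ((∃ ι : Matrix (Fin n) (Fin n) ℝ →ₗ⁅ℝ⁆ Der1 n d,
          Function.Injective ι ∧
          (∀ A j, ι A (FreeNilp.gen n d j) = ∑ i, A i j • FreeNilp.gen n d i) ∧
          LinearMap.range (ι : Matrix (Fin n) (Fin n) ℝ →ₗ[ℝ] Der1 n d) =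
            FreeNilp.derDeg n d 0) ∧
        DirectSum.IsInternal (fun k : Fin d => FreeNilp.derDeg n d (k : ℕ)) ∧
        IsCompl (FreeNilp.derDeg n d 0) (FreeNilp.UL n d)) ∧
      -- `D² L[V,d] = 𝔤𝔩 + UL[V,d] + Hom_𝔰𝔩(U_gen⁺ ∩ UL^{(d-1)}, UL^{(d-1)})`
      (Function.Injective (LieDerivation.ad ℝ (Der1 n d)) ∧
        (∃ U P : Submodule ℝ (Der1 n d), FreeNilp.IsUgen U ∧ FreeNilp.IsUgenPlus U P) ∧
        ∀ U P : Submodule ℝ (Der1 n d), FreeNilp.IsUgen U → FreeNilp.IsUgenPlus U P →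
          ∃ Φ : FreeNilp.homSl (P ⊓ FreeNilp.derDeg n d (d - 1))
                  (FreeNilp.derDeg n d (d - 1)) →ₗ[ℝ] Der2 n d,
            Function.Injective Φ ∧
            (∀ φ,
              (∀ k < d - 1, ∀ δ ∈ FreeNilp.derDeg n d k, Φ φ δ = 0) ∧
              (∀ δ ∈ FreeNilp.commUL n d, Φ φ δ = 0) ∧
              (∀ δ ∈ FreeNilp.adV n d, Φ φ δ = 0) ∧
              ∀ u : ↥(P ⊓ FreeNilp.derDeg n d (d - 1)),
                Φ φ (u : Der1 n d) = (φ.1 u : Der1 n d)) ∧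
            IsCompl
              (LinearMap.range (LieDerivation.ad ℝ (Der1 n d) : Der1 n d →ₗ[ℝ] Der2 n d))
              (LinearMap.range Φ)) ∧
      -- the tower stabilizes at the second level
      ∀ k, 2 ≤ k → StabilizesAtLevel (FreeNilp n d) k) ∧
    (n = 2 ∧ d = 2 → ∀ k, 1 ≤ k → StabilizesAtLevel (FreeNilp n d) k) := by
  refine ⟨fun _ => ⟨⟨⟨FreeNilp.glAct n d, FreeNilp.glAct_injective (by omega),
    FreeNilp.glAct_gen, FreeNilp.range_glAct⟩, FreeNilp.isInternal_derDeg,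
    FreeNilp.isCompl_derDeg_zero⟩, ⟨FreeNilp.ad_injective hn hd,
    FreeNilp.exists_isUgen_isUgenPlus, fun U P hU hP => ?_⟩, fun k hk =>
    StabilizesAtLevel.of_le hk (FreeNilp.ad_der2_bijective hn hd)⟩, ?_⟩
  · have hc := FreeNilp.isCompl_outerKer hd hU hP
    refine ⟨FreeNilp.outerDer hd hP hc, ?_, fun φ => ⟨fun k hk δ hδ => ?_, fun δ hδ => ?_,
      fun δ hδ => ?_, fun u => FreeNilp.extendZero_coe u⟩, ?_, ?_⟩
    · rw [injective_iff_map_eq_zero]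
      intro φ hφ
      ext u : 3
      have := FreeNilp.extendZero_coe (hc := hc) (φ := φ.1) u
      rw [← FreeNilp.outerDer_apply hd hP, hφ] at this
      exact this.symm
    · exact FreeNilp.extendZero_of_mem (FreeNilp.derDeg_le_outerKer hk hδ)
    · exact FreeNilp.extendZero_of_mem (FreeNilp.commUL_le_outerKer hδ)
    · exact FreeNilp.extendZero_of_mem (FreeNilp.adV_le_outerKer hδ)
    · rw [Submodule.disjoint_def]
      rintro _ ⟨x, rfl⟩ ⟨φ, hφ⟩
      -- A derivation that is both inner and outer vanishes, so the two ranges meet trivially.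
      have hx : FreeNilp.IsOuter (LieDerivation.ad ℝ (Der1 n d) x) :=
        hφ ▸ FreeNilp.isOuter_outerDer hd hP φ
      rw [FreeNilp.eq_zero_of_isOuter_ad hn hd hx, map_zero]
    · rw [codisjoint_iff, eq_top_iff]
      rintro D -
      obtain ⟨x, hx⟩ := FreeNilp.exists_isOuter_sub_ad hn hd D
      obtain ⟨φ, hφ⟩ := FreeNilp.exists_outerDer_eq (hc := hc) hn hd hP hx
      rw [← add_sub_cancel (LieDerivation.ad ℝ (Der1 n d) x) D, ← hφ]
      exact Submodule.add_mem_sup ⟨x, rfl⟩ ⟨φ, rfl⟩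
  · rintro ⟨rfl, rfl⟩ k hk
    exact StabilizesAtLevel.of_le hk FreeNilp.ad_der1_bijective_of_two
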